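/- Let $k\ge 2$ and let $X$ be a nonempty paracompact Hausdorff compactly generated space (for example any nonempty CW-complex). Let $SX$ be its unreduced suspension, and suppose that the number $n_{SX} := |[SX, SO_{2k}]|$ of free homotopy classes of continuous maps $SX\to SO_{2k}$ is finite. For an oriented Euclidean vector bundle $E\to SX$ of rank $2k$ let $\mathcal G_E$ be its gauge group, i.e. the group of bundle automorphisms of $E$ that are orientation-preserving isometries on each fibre, with the compact-open topology (equivalently, the gauge group of the principal $SO_{2k}$-bundle of oriented orthonormal frames of $E$). Let $\eta$ be a loop in $SO_{2k}$ based at the identity that represents the generator of $\pi_1(SO_{2k})\cong \mathbb Z/2$. The bundle $E$ is called $\eta$-turnable if there is a loop $(\psi_t)_{t\in[0,1]}$ in $\mathcal G_E$ based at $\mathrm{id}_E$ whose restriction to each fibre $E_b$, under an orientation-preserving isometry $E_b\cong\mathbb R^{2k}$, is path homotopic to $\eta$. Then for every oriented Euclidean vector bundle $E\to SX$ of rank $2k$ $$|\pi_0(\mathcal G_E)| = \begin{cases} n_{SX} & \text{if } E \text{ is } \eta\text{-turnable},\\ \tfrac{1}{2}\, n_{SX} & \text{if } E \text{ is not } \eta\text{-turnable}.\end{cases}$$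 In particular, $\eta$-turnability is a homotopy invariant of the gauge groups of these bundles: if $E$ and $E'$ are two oriented Euclidean vector bundles of rank $2k$ over $SX$ and $\mathcal G_E$ is homotopy equivalent to $\mathcal G_{E'}$, then $E$ is $\eta$-turnable if and only if $E'$ is. -/

import Mathlib

open Bundle Topology
open scoped unitInterval ContinuousMap

universe u v w

/-- The relation on `X × I` that collapses `X × {0}` to a point and `X × {1}` to a point. -/
def suspensionSetoid (X : Type u) : Setoid (X × I) where
  r p q := p = q ∨ (p.2 = 0 ∧ q.2 = 0) ∨ (p.2 = 1 ∧ q.2 = 1)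
  iseqv :=
    { refl := fun _ => Or.inl rfl
      symm := by
        rintro p q (h | ⟨h, h'⟩ | ⟨h, h'⟩)
        · exact Or.inl h.symm
        · exact Or.inr (Or.inl ⟨h', h⟩)
        · exact Or.inr (Or.inr ⟨h', h⟩)
      trans := by
        rintro p q r (rfl | ⟨h, h'⟩ | ⟨h, h'⟩) (rfl | ⟨k, k'⟩ | ⟨k, k'⟩)
        · exact Or.inl rfl
        · exact Or.inr (Or.inl ⟨k, k'⟩)
        · exact Or.inr (Or.inr ⟨k, k'⟩)
        · exact Or.inr (Or.inl ⟨h, h'⟩)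
        · exact Or.inr (Or.inl ⟨h, k'⟩)
        · exact absurd (h'.symm.trans k) zero_ne_one
        · exact Or.inr (Or.inr ⟨h, h'⟩)
        · exact absurd (k.symm.trans h') zero_ne_one
        · exact Or.inr (Or.inr ⟨h, k'⟩) }

/-- The unreduced suspension `SX` of a (nonempty) space, i.e. the union of two cones on `X`,
with the quotient topology from `X × I`. -/
def Suspension (X : Type u) : Type u := Quotient (suspensionSetoid X)

instance Suspension.instTopologicalSpace (X : Type u) [TopologicalSpace X] :
    TopologicalSpace (Suspension X) :=
  inferInstanceAs (TopologicalSpace (Quotient (suspensionSetoid X)))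

/-- The set `[X, Y]` of (free) homotopy classes of continuous maps. -/
def HomotopyClasses (X : Type u) (Y : Type v) [TopologicalSpace X] [TopologicalSpace Y] :
    Type (max u v) :=
  Quotient (Setoid.mk (ContinuousMap.Homotopic (X := X) (Y := Y))
    ContinuousMap.Homotopic.equivalence)

/-- The special orthogonal group `SO_n`, a topological group as a subspace of the matrices. -/
abbrev SO (n : ℕ) := Matrix.specialOrthogonalGroup (Fin n) ℝ

/-- Euclidean space `ℝⁿ`. -/
abbrev Euc (n : ℕ) := EuclideanSpace ℝ (Fin n)

/-- The standard orientation of `ℝⁿ`. -/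
noncomputable def stdOrientation (n : ℕ) : Orientation ℝ (Euc n) (Fin n) :=
  (EuclideanSpace.basisFun (Fin n) ℝ).toBasis.orientation

/-- An oriented Euclidean vector bundle of rank `n` over `B`: a real vector bundle with a
continuously varying inner product on its fibres and a continuous choice of orientations. -/
structure OrientedEuclideanBundle (B : Type u) [TopologicalSpace B] (n : ℕ) where
  /-- the fibres -/
  Fib : B → Type v
  [normed : ∀ b, NormedAddCommGroup (Fib b)]
  [innerProduct : ∀ b, InnerProductSpace ℝ (Fib b)]
  [totalTopology : TopologicalSpace (TotalSpace (Euc n) Fib)]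
  [fiberBundle : FiberBundle (Euc n) Fib]
  [vectorBundle : VectorBundle ℝ (Euc n) Fib]
  [riemannian : IsContinuousRiemannianBundle (Euc n) Fib]
  /-- the orientations of the fibres -/
  orient : ∀ b, Orientation ℝ (Fib b) (Fin n)
  /-- near every point there is a local trivialization by orientation-preserving isomorphisms -/
  orient_continuous : ∀ b : B, ∃ (e : Trivialization (Euc n) (TotalSpace.proj (E := Fib)))
    (_ : e.IsLinear ℝ), b ∈ e.baseSet ∧ ∀ (c : B) (hc : c ∈ e.baseSet),
      Orientation.map (Fin n) (e.linearEquivAt ℝ c hc) (orient c) = stdOrientation n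

namespace OrientedEuclideanBundle

attribute [instance] normed innerProduct totalTopology fiberBundle vectorBundle riemannian

variable {B : Type u} [TopologicalSpace B] {n : ℕ} (E : OrientedEuclideanBundle.{u, v} B n)

/-- The total space. -/
abbrev Total : Type (max u v) := TotalSpace (Euc n) E.Fib

/-- The gauge group `𝒢_E`: the group of automorphisms of `E`, that is of self-homeomorphisms of
the total space that map each fibre to itself by an orientation-preserving linear isometry. -/
def gaugeGroup : Subgroup (E.Total ≃ₜ E.Total) where
  carrier := {h | ∃ φ : ∀ b, E.Fib b ≃ₗᵢ[ℝ] E.Fib b,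
    (∀ b, Orientation.map (Fin n) (φ b).toLinearEquiv (E.orient b) = E.orient b) ∧
    ∀ (b : B) (x : E.Fib b), h ⟨b, x⟩ = ⟨b, φ b x⟩}
  one_mem' := ⟨fun _ => LinearIsometryEquiv.refl ℝ _,
    fun b => by
      change Orientation.map (Fin n) (LinearEquiv.refl ℝ (E.Fib b)) (E.orient b) = E.orient b
      simp,
    fun _ _ => rfl⟩
  mul_mem' := by
    rintro h h' ⟨φ, hφ, hh⟩ ⟨φ', hφ', hh'⟩
    refine ⟨fun b => (φ' b).trans (φ b), fun b => ?_, fun b x => ?_⟩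
    · conv_rhs => rw [← hφ b, ← hφ' b]
      induction E.orient b using Module.Ray.ind with
      | h f hf => rfl
    · change h (h' ⟨b, x⟩) = _
      rw [hh', hh]
      rfl
  inv_mem' := by
    rintro h ⟨φ, hφ, hh⟩
    refine ⟨fun b => (φ b).symm, fun b => ?_, fun b x => ?_⟩
    · conv_lhs => rw [← hφ b]
      exact (Orientation.map (Fin n) (φ b).toLinearEquiv).symm_apply_apply (E.orient b)
    · change h.symm ⟨b, x⟩ = _
      rw [Homeomorph.symm_apply_eq, hh]
      simp

/-- The gauge group carries the compact-open topology. -/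
instance gaugeGroup.instTopologicalSpace : TopologicalSpace E.gaugeGroup :=
  TopologicalSpace.induced (fun h => (h.1 : C(E.Total, E.Total))) inferInstance

/-- A frame of `E` over `b`, i.e. an orientation-preserving isometry from `ℝⁿ` to the fibre. -/
structure Frame (b : B) where
  /-- the underlying isometry -/
  iso : Euc n ≃ₗᵢ[ℝ] E.Fib b
  map_orient : Orientation.map (Fin n) iso.toLinearEquiv (stdOrientation n) = E.orient b

/-- `E` is `η`-turnable, for a loop `η` in `SO_n` based at the identity: there is a loop `ψ` in the
gauge group, based at the identity, whose restriction to each fibre, read in any frame `p` as the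
loop `δ` in `SO_n` with `ψ_t ∘ p = p ∘ δ_t`, is homotopic to `η` relative to the end points. -/
def IsTurnable (η : Path (1 : SO n) 1) : Prop :=
  ∃ ψ : Path (1 : E.gaugeGroup) 1, ∀ (b : B) (p : E.Frame b), ∃ δ : Path (1 : SO n) 1,
    (∀ (t : I) (x : Euc n),
      (ψ t).1 ⟨b, p.iso x⟩ = ⟨b, p.iso (Matrix.toEuclideanLin (δ t).1 x)⟩) ∧
    δ.Homotopic η

end OrientedEuclideanBundle

/-! Pull `E` back along the quotient map `X × I → SX`. The covering homotopy theorem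
(`PrincipalBundle.exists_lift`) trivializes the pull-back, and `E` is then encoded by a clutching
function `g : X → SO_n`. A gauge transformation becomes a map `f : X × I → SO_n` that is constant at
the bottom and, after conjugation by `g`, constant at the top (`Clutching.gaugeEquiv`). For `g = 1`
such maps are exactly the maps `SX → SO_n`. So the two numbers to compare count the components of
`twistedMaps g` and of `twistedMaps 1` (`Clutching.card_zerothHomotopy`,
`Suspension.card_homotopyClasses`).

Both are compared with one group that does not depend on `g`: the maps that are `1` at both ends.
Since `SO_n` is path connected, every component of `twistedMaps g` meets this group, so the count is
the index of a subgroup `N_g` (`index_nullClasses`). Following the end values of a null-homotopy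
shows that `N_g` consists of the classes `A · g⁻¹Bg` with loops `A`, `B` in `SO_n`
(`mem_nullClasses_iff`). Up to homotopy a loop is `1` or `η`, and `η² = 1`; hence `N_1 ≤ N_g`, and
`N_g` is the union of `N_1` and its coset by `g⁻¹ηg`. The index of `N_1` in `N_g` is therefore 1 or
2, according to whether `g⁻¹ηg` lies in `N_1` (`card_twistedMaps`).

This condition is turnability: a homotopy from `η` to `g⁻¹ηg`, with its homotopy parameter read as
the suspension coordinate and its loop coordinate as time, is a loop of twisted maps
(`isTurnableTwist_iff`, `Clutching.isTurnable_iff`).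

The relation `η² = 1` is proved geometrically. General position and reflections deform a loop in
`SO_n` into the rotations of one coordinate plane; for `n ≥ 3` these rotations are inverted by
conjugation with an element of `SO_n`, and such a conjugation does not change the class of a loop
(`SO.trans_self_homotopic_refl`). Homotopy invariance follows because a positive finite number
differs from its half. -/

section TwistedMaps

/-! ### Components of the group of twisted maps, for a general topological group. -/

variable {X : Type*} [TopologicalSpace X] {Y : Type*} [TopologicalSpace Y]
  {G : Type*} [TopologicalSpace G] [Group G] [IsTopologicalGroup G]

/-- The elements of a group `H` of maps `Y → G` that can be joined to the constant map `1` by a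
homotopy through elements of `H`. -/
def nullHomotopicIn (H : Subgroup C(Y, G)) : Subgroup C(Y, G) where
  carrier := {f | ∃ F : C(I × Y, G), (∀ y, F (0, y) = 1) ∧ (∀ y, F (1, y) = f y) ∧
    ∀ s, F.curry s ∈ H}
  one_mem' := ⟨1, fun _ => rfl, fun _ => rfl, fun s => by
    convert H.one_mem; ext; rfl⟩
  mul_mem' := by
    rintro f f' ⟨F, h0, h1, h⟩ ⟨F', h0', h1', h'⟩
    refine ⟨F * F', fun y => by simp [h0, h0'], fun y => by simp [h1, h1'], fun s => ?_⟩
    convert H.mul_mem (h s) (h' s)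
    ext; rfl
  inv_mem' := by
    rintro f ⟨F, h0, h1, h⟩
    refine ⟨F⁻¹, fun y => by simp [h0], fun y => by simp [h1], fun s => ?_⟩
    convert H.inv_mem (h s)
    ext; rfl

lemma nullHomotopicIn_mono {H K : Subgroup C(Y, G)} (h : H ≤ K) :
    nullHomotopicIn H ≤ nullHomotopicIn K := by
  rintro f ⟨F, h0, h1, hF⟩
  exact ⟨F, h0, h1, fun s => h (hF s)⟩

instance nullHomotopicIn_normal (H : Subgroup C(Y, G)) :
    ((nullHomotopicIn H).subgroupOf H).Normal := by
  constructor
  rintro ⟨f, hf⟩ hf' ⟨k, hk⟩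
  obtain ⟨F, h0, h1, hF⟩ := hf'
  refine ⟨k.comp ContinuousMap.snd * F * (k.comp ContinuousMap.snd)⁻¹, fun y => by simp [h0],
    fun y => by simp [h1], fun s => ?_⟩
  convert H.mul_mem (H.mul_mem hk (hF s)) (H.inv_mem hk)
  ext; rfl

/-- The maps `f : X × I → G` for which `f(x, 0)` and `g(x) f(x, 1) g(x)⁻¹` do not depend
on `x`. -/
def twistedMaps (g : C(X, G)) : Subgroup C(X × I, G) where
  carrier := {f | (∃ a, ∀ x, f (x, 0) = a) ∧ ∃ b, ∀ x, g x * f (x, 1) * (g x)⁻¹ = b}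
  one_mem' := ⟨⟨1, fun _ => rfl⟩, ⟨1, fun x => by simp⟩⟩
  mul_mem' := by
    rintro f f' ⟨⟨a, ha⟩, b, hb⟩ ⟨⟨a', ha'⟩, b', hb'⟩
    refine ⟨⟨a * a', fun x => by simp [ha, ha']⟩, b * b', fun x => ?_⟩
    rw [← hb x, ← hb' x]; simp [mul_assoc]
  inv_mem' := by
    rintro f ⟨⟨a, ha⟩, b, hb⟩
    refine ⟨⟨a⁻¹, fun x => by simp [ha]⟩, b⁻¹, fun x => ?_⟩
    rw [← hb x]; simp [mul_assoc]

/-- The maps `f : X × I → G` that are `1` at both ends. -/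
def relMaps (X G : Type*) [TopologicalSpace X] [TopologicalSpace G] [Group G]
    [IsTopologicalGroup G] : Subgroup C(X × I, G) where
  carrier := {f | (∀ x, f (x, 0) = 1) ∧ ∀ x, f (x, 1) = 1}
  one_mem' := ⟨fun _ => rfl, fun _ => rfl⟩
  mul_mem' := by
    rintro f f' ⟨ha, hb⟩ ⟨ha', hb'⟩
    exact ⟨fun x => by simp [ha, ha'], fun x => by simp [hb, hb']⟩
  inv_mem' := by
    rintro f ⟨ha, hb⟩
    exact ⟨fun x => by simp [ha], fun x => by simp [hb]⟩

lemma relMaps_le (g : C(X, G)) : relMaps X G ≤ twistedMaps g := by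
  rintro f ⟨h0, h1⟩
  exact ⟨⟨1, h0⟩, 1, fun x => by simp [h1]⟩

lemma homotopic_of_square {Z : Type*} [TopologicalSpace Z] {a b : Z} {B B' : Path a b}
    (F : C(I × I, Z)) (h0 : ∀ t, F (0, t) = B t) (h1 : ∀ t, F (1, t) = B' t)
    (hl : ∀ s, F (s, 0) = a) (hr : ∀ s, F (s, 1) = b) :
    B.Homotopic B' :=
  ⟨{ toContinuousMap := F
     map_zero_left := h0
     map_one_left := h1
     prop' := by
      rintro s t (rfl | rfl)
      · simpa using hl s
      · simpa using hr s }⟩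

lemma exists_square {Z : Type*} [TopologicalSpace Z] {a b : Z} {B B' : Path a b}
    (h : B.Homotopic B') :
    ∃ F : C(I × I, Z), (∀ t, F (0, t) = B t) ∧ (∀ t, F (1, t) = B' t) ∧ (∀ s, F (s, 0) = a) ∧
      ∀ s, F (s, 1) = b := by
  obtain ⟨F⟩ := h
  exact ⟨F.toContinuousMap, fun t => F.map_zero_left t, fun t => F.map_one_left t,
    fun s => F.source s, fun s => F.target s⟩

/-- A loop conjugated by a fixed element. -/
def conjPath (a : G) (B : Path (1 : G) 1) : Path (1 : G) 1 where
  toFun t := a⁻¹ * B t * a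
  continuous_toFun := by fun_prop
  source' := by simp
  target' := by simp

@[simp] lemma conjPath_apply (a : G) (B : Path (1 : G) 1) (t : I) :
    conjPath a B t = a⁻¹ * B t * a := rfl

/-- Move the conjugating element to `1` along a path; conjugation fixes `1`, so the end points stay
put. -/
lemma conjPath_homotopic [PathConnectedSpace G] (a : G) (B : Path (1 : G) 1) :
    (conjPath a B).Homotopic B := by
  let p : Path a 1 := PathConnectedSpace.somePath a 1
  exact homotopic_of_square ⟨fun z => (p z.1)⁻¹ * B z.2 * p z.1, by fun_prop⟩
    (fun t => by simp) (fun t => by simp) (fun s => by simp) (fun s => by simp)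

/-- The map `(x, t) ↦ g(x)⁻¹ B(t) g(x)`, for a loop `B`. -/
def conjLoop (g : C(X, G)) (B : Path (1 : G) 1) : relMaps X G :=
  ⟨⟨fun z => (g z.1)⁻¹ * B z.2 * g z.1, by fun_prop⟩, fun x => by simp, fun x => by simp⟩

@[simp] lemma conjLoop_apply (g : C(X, G)) (B : Path (1 : G) 1) (x : X) (t : I) :
    (conjLoop g B).1 (x, t) = (g x)⁻¹ * B t * g x := rfl

variable (X G) in
/-- The group of homotopy classes of maps `X × I → G` relative to both ends. -/
abbrev RelClasses : Type _ := relMaps X G ⧸ (nullHomotopicIn (relMaps X G)).subgroupOf (relMaps X G)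

/-- The class of `(x, t) ↦ g(x)⁻¹ B(t) g(x)`, for a loop `B`. -/
def conjClass (g : C(X, G)) (B : Path (1 : G) 1) : RelClasses X G :=
  QuotientGroup.mk (conjLoop g B)

lemma relClasses_mk_eq_of_homotopy (f f' : relMaps X G) (F : C(I × (X × I), G))
    (h0 : ∀ y, F (0, y) = f.1 y) (h1 : ∀ y, F (1, y) = f'.1 y)
    (h : ∀ s, F.curry s ∈ relMaps X G) :
    (QuotientGroup.mk f : RelClasses X G) = QuotientGroup.mk f' := by
  rw [QuotientGroup.eq]
  refine ⟨((f⁻¹).1.comp ContinuousMap.snd) * F, fun y => by simp [h0], fun y => by simp [h1],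
    fun s => ?_⟩
  convert (relMaps X G).mul_mem (f⁻¹).2 (h s)
  ext; rfl

lemma conjClass_congr (g : C(X, G)) {B B' : Path (1 : G) 1} (h : B.Homotopic B') :
    conjClass g B = conjClass g B' := by
  obtain ⟨F, h0, h1, hl, hr⟩ := exists_square h
  exact relClasses_mk_eq_of_homotopy _ _
    ⟨fun z => (g z.2.1)⁻¹ * F (z.1, z.2.2) * g z.2.1, by fun_prop⟩
    (fun y => by simp [h0, conjLoop]) (fun y => by simp [h1, conjLoop])
    (fun s => ⟨fun x => by simp [hl], fun x => by simp [hr]⟩)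

@[simp] lemma conjClass_refl (g : C(X, G)) : conjClass g (Path.refl 1) = 1 := by
  have : conjLoop g (Path.refl 1) = 1 := by
    ext y; simp [conjLoop]
  rw [conjClass, this, QuotientGroup.mk_one]

lemma conjClass_trans (g : C(X, G)) (B B' : Path (1 : G) 1) :
    conjClass g (B.trans B') = conjClass g B * conjClass g B' := by
  -- Once padded by constant loops, the two factors are never both different from `1`, so
  -- concatenation is a pointwise product.
  have h1 : conjLoop g (B.trans B') =
      conjLoop g (B.trans (Path.refl 1)) * conjLoop g ((Path.refl 1).trans B') := by
    ext ⟨x, t⟩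
    simp only [Subgroup.coe_mul, ContinuousMap.mul_apply, conjLoop_apply, Path.trans_apply]
    split_ifs <;> simp
  have h2 : conjClass g B = conjClass g (B.trans (Path.refl 1)) :=
    conjClass_congr g ⟨(Path.Homotopy.transRefl B).symm⟩
  have h3 : conjClass g B' = conjClass g ((Path.refl 1).trans B') :=
    conjClass_congr g ⟨(Path.Homotopy.reflTrans B').symm⟩
  rw [h2, h3, conjClass, h1, QuotientGroup.mk_mul]
  rfl

/-- The map `(x, t) ↦ α(1 - t) g(x)⁻¹ β(t) g(x)` is null-homotopic through twisted maps. -/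
lemma ramp_mem (g : C(X, G)) (α β : C(I, G)) (hα : α 0 = 1) (hβ : β 0 = 1)
    (f : C(X × I, G)) (hf : ∀ x t, f (x, t) = α (σ t) * ((g x)⁻¹ * β t * g x)) :
    f ∈ nullHomotopicIn (twistedMaps g) := by
  -- At stage `s` the value is `α s` at the bottom and `g⁻¹ (β s) g` at the top, so every stage is
  -- twisted although the ends move.
  refine ⟨⟨fun z => α (z.1 * σ z.2.2) * ((g z.2.1)⁻¹ * β (z.1 * z.2.2) * g z.2.1), by fun_prop⟩,
    fun y => by simp [hα, hβ], fun y => by simp [hf], fun s => ⟨⟨α s, fun x => by simp [hβ]⟩,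
    β s, fun x => ?_⟩⟩
  simp [hα, mul_assoc]

lemma conjLoop_one_mem (g : C(X, G)) (A : Path (1 : G) 1) :
    (conjLoop 1 A).1 ∈ nullHomotopicIn (twistedMaps g) :=
  ramp_mem g A.symm 1 (by simp) rfl _ (fun x t => by simp)

lemma conjLoop_mem (g : C(X, G)) (B : Path (1 : G) 1) :
    (conjLoop g B).1 ∈ nullHomotopicIn (twistedMaps g) :=
  ramp_mem g 1 B rfl (by simp) _ (fun x t => by simp)

/-- The homotopy classes relative to the ends that are null-homotopic through twisted maps. -/
def nullClasses (g : C(X, G)) : Subgroup (relMaps X G) :=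
  (nullHomotopicIn (twistedMaps g)).subgroupOf (relMaps X G)

lemma mem_nullClasses {g : C(X, G)} {f : relMaps X G} :
    f ∈ nullClasses g ↔ f.1 ∈ nullHomotopicIn (twistedMaps g) := Subgroup.mem_subgroupOf

lemma mem_nullClasses_of_mk_eq {g : C(X, G)} {f f' : relMaps X G}
    (h : (QuotientGroup.mk f : RelClasses X G) = QuotientGroup.mk f') (hf : f ∈ nullClasses g) :
    f' ∈ nullClasses g := by
  rw [QuotientGroup.eq] at h
  have : f⁻¹ * f' ∈ nullClasses g := nullHomotopicIn_mono (relMaps_le g) h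
  simpa using mul_mem hf this

/-- The end values of a null-homotopy through twisted maps are a loop at the bottom and a conjugated
loop at the top. They are the only obstruction to making the homotopy relative to the ends, and a
ramp with the same end values removes them. -/
lemma mem_nullClasses_iff [Nonempty X] (g : C(X, G)) (f : relMaps X G) :
    f ∈ nullClasses g ↔
      ∃ A B : Path (1 : G) 1, QuotientGroup.mk f = conjClass 1 A * conjClass g B := by
  constructor
  · intro hf
    obtain ⟨F, h0, h1, hF⟩ := mem_nullClasses.1 hf
    obtain ⟨x₀⟩ := ‹Nonempty X›
    let A : Path (1 : G) 1 :=
      { toFun := fun s => F (s, (x₀, 0))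
        continuous_toFun := by fun_prop
        source' := by simp [h0]
        target' := by simp [h1, f.2.1] }
    let B : Path (1 : G) 1 :=
      { toFun := fun s => g x₀ * F (s, (x₀, 1)) * (g x₀)⁻¹
        continuous_toFun := by fun_prop
        source' := by simp [h0]
        target' := by simp [h1, f.2.2] }
    have hA : ∀ s x, F (s, (x, 0)) = A s := fun s x => by
      obtain ⟨a, ha⟩ := (hF s).1
      exact (ha x).trans (ha x₀).symm
    have hB : ∀ s x, F (s, (x, 1)) = (g x)⁻¹ * B s * g x := fun s x => by
      obtain ⟨b, hb⟩ := (hF s).2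
      have : g x * F (s, (x, 1)) * (g x)⁻¹ = B s := (hb x).trans (hb x₀).symm
      rw [← this]; simp [mul_assoc]
    -- The ramp runs through the bottom loop as `A (σ t)`, hence the reversal.
    refine ⟨A.symm, B, ?_⟩
    suffices (1 : RelClasses X G) = QuotientGroup.mk (f * (conjLoop 1 A.symm * conjLoop g B)⁻¹) by
      rw [QuotientGroup.mk_mul, QuotientGroup.mk_inv] at this
      exact (mul_inv_eq_one.1 this.symm)
    rw [← QuotientGroup.mk_one]
    refine relClasses_mk_eq_of_homotopy _ _
      ⟨fun z => F z * (A (z.1 * σ z.2.2) * ((g z.2.1)⁻¹ * B (z.1 * z.2.2) * g z.2.1))⁻¹,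
        by fun_prop⟩ (fun y => by simp [h0]) (fun y => by simp [h1, conjLoop])
      (fun s => ⟨fun x => by simp [hA], fun x => by simp [hB, mul_assoc]⟩)
  · rintro ⟨A, B, h⟩
    exact mem_nullClasses_of_mk_eq (f := conjLoop 1 A * conjLoop g B) h.symm
      (mul_mem (mem_nullClasses.2 (conjLoop_one_mem g A)) (mem_nullClasses.2 (conjLoop_mem g B)))

/-- Paths from `1` to the inverses of the two end values give a ramp, null-homotopic through twisted
maps, whose product with `f` is `1` at both ends. -/
lemma exists_relMaps_mul [PathConnectedSpace G] [Nonempty X] (g : C(X, G)) {f : C(X × I, G)}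
    (hf : f ∈ twistedMaps g) :
    ∃ k ∈ relMaps X G, f⁻¹ * k ∈ nullHomotopicIn (twistedMaps g) := by
  obtain ⟨⟨a, ha⟩, b, hb⟩ := hf
  let α : Path (1 : G) a⁻¹ := PathConnectedSpace.somePath _ _
  let β : Path (1 : G) b⁻¹ := PathConnectedSpace.somePath _ _
  let r : C(X × I, G) := ⟨fun z => α (σ z.2) * ((g z.1)⁻¹ * β z.2 * g z.1), by fun_prop⟩
  have hr : r ∈ nullHomotopicIn (twistedMaps g) :=
    ramp_mem g α β (by simp) (by simp) r (fun x t => rfl)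
  refine ⟨f * r, ⟨fun x => by simp [r, ha], fun x => ?_⟩, by simpa using hr⟩
  have hb' := hb x
  simp only [r, ContinuousMap.mul_apply, ContinuousMap.coe_mk]
  simp [← hb', mul_assoc]

/-- `nullClasses g` is the kernel of the map from `relMaps X G` to the components of the twisted
maps, which is onto by `exists_relMaps_mul`. Counts for different `g` thereby become indices in the
same group. -/
lemma index_nullClasses [PathConnectedSpace G] [Nonempty X] (g : C(X, G)) :
    (nullClasses g).index =
      Nat.card (twistedMaps g ⧸ (nullHomotopicIn (twistedMaps g)).subgroupOf (twistedMaps g)) := by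
  let φ : relMaps X G →* twistedMaps g ⧸ (nullHomotopicIn (twistedMaps g)).subgroupOf _ :=
    (QuotientGroup.mk' _).comp (Subgroup.inclusion (relMaps_le g))
  have hk : nullClasses g = φ.ker := by
    ext f
    rw [MonoidHom.mem_ker, mem_nullClasses]
    change _ ↔ (QuotientGroup.mk _ : twistedMaps g ⧸ _) = 1
    rw [QuotientGroup.eq_one_iff]
    rfl
  have hs : Function.Surjective φ := by
    intro q
    induction q using QuotientGroup.induction_on with
    | H f =>
      obtain ⟨k, hk, h⟩ := exists_relMaps_mul g f.2
      refine ⟨⟨k, hk⟩, Eq.symm ?_⟩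
      change QuotientGroup.mk f = QuotientGroup.mk _
      rw [QuotientGroup.eq]
      exact h
  rw [hk, Subgroup.index_ker, MonoidHom.range_eq_top.2 hs, Subgroup.card_top]

/-- There is a loop of twisted maps, based at the constant map `1`, whose evaluation at every point
is homotopic to `η`. -/
def IsTurnableTwist (g : C(X, G)) (η : Path (1 : G) 1) : Prop :=
  ∃ F : C(I × (X × I), G), (∀ s, F.curry s ∈ twistedMaps g) ∧
    ∀ y, ∃ δ : Path (1 : G) 1, (∀ s, δ s = F (s, y)) ∧ δ.Homotopic η

variable {η : Path (1 : G) 1}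

lemma isTurnableTwist_of_conjClass_eq {g : C(X, G)} (h : conjClass g η = conjClass 1 η) :
    IsTurnableTwist g η := by
  have h' := h.symm
  simp only [conjClass, QuotientGroup.eq] at h'
  obtain ⟨F, h0, h1, hF⟩ := h'
  have hF0 : ∀ s x, F (s, (x, 0)) = 1 := fun s => (hF s).1
  have hF1 : ∀ s x, F (s, (x, 1)) = 1 := fun s => (hF s).2
  have h1' : ∀ x t, F (1, (x, t)) = (η t)⁻¹ * ((g x)⁻¹ * η t * g x) := fun x t => by
    rw [h1]; simp
  -- The two interval coordinates are exchanged. Since `F` runs from `1` to `η⁻¹ · g⁻¹ηg`, the map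
  -- `W` at time `s` is `η s` at the bottom and `g⁻¹ (η s) g` at the top.
  let W : C(I × (X × I), G) := ⟨fun z => η z.1 * F (z.2.2, (z.2.1, z.1)), by fun_prop⟩
  refine ⟨W, fun s => ⟨⟨η s, fun x => by simp [W, h0]⟩, η s, fun x => ?_⟩, ?_⟩
  · simp [W, h1', mul_assoc]
  · rintro ⟨x, t⟩
    refine ⟨⟨⟨fun s => W (s, (x, t)), by fun_prop⟩, by simp [W, hF0], by simp [W, hF1]⟩,
      fun s => rfl, ?_⟩
    -- Sliding the point down to the bottom of the cylinder deforms its loop to `η`.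
    refine Path.Homotopic.symm (homotopic_of_square
      ⟨fun z => W (z.2, (x, z.1 * t)), by fun_prop⟩ ?_ ?_ ?_ ?_)
    · intro s; simp [W, h0]
    · intro s; simp [W]
    · intro s; simp [W, hF0]
    · intro s; simp [W, hF1]

variable [PathConnectedSpace G] [Nonempty X]

/-- The same exchange of coordinates, read backwards: the loop of twisted maps is a relative
homotopy from its bottom loop to its conjugated top loop, and both underlying loops are homotopic to
`η`. -/
lemma conjClass_eq_of_isTurnableTwist {g : C(X, G)} (h : IsTurnableTwist g η) :
    conjClass g η = conjClass 1 η := by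
  obtain ⟨F, hF, hδ⟩ := h
  obtain ⟨x₀⟩ := ‹Nonempty X›
  obtain ⟨A, hA, hAη⟩ := hδ (x₀, 0)
  obtain ⟨B', hB', hBη'⟩ := hδ (x₀, 1)
  obtain ⟨B, hB, hBη⟩ : ∃ B : Path (1 : G) 1, (∀ s, B s = g x₀ * F (s, (x₀, 1)) * (g x₀)⁻¹) ∧
      B.Homotopic η :=
    ⟨conjPath (g x₀)⁻¹ B', fun s => by simp [hB'], (conjPath_homotopic _ _).trans hBη'⟩
  have hA : ∀ s x, F (s, (x, 0)) = A s := fun s x => by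
    obtain ⟨a, ha⟩ := (hF s).1
    rw [hA]
    exact (ha x).trans (ha x₀).symm
  have hB : ∀ s x, F (s, (x, 1)) = (g x)⁻¹ * B s * g x := fun s x => by
    obtain ⟨b, hb⟩ := (hF s).2
    have : g x * F (s, (x, 1)) * (g x)⁻¹ = B s := by
      rw [hB]; exact (hb x).trans (hb x₀).symm
    rw [← this]; simp [mul_assoc]
  rw [← conjClass_congr g hBη, ← conjClass_congr 1 hAη]
  have hend : ∀ y, F (0, y) = 1 ∧ F (1, y) = 1 := fun y => by
    obtain ⟨δ, hδ, -⟩ := hδ y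
    exact ⟨by simp [← hδ], by simp [← hδ]⟩
  refine (relClasses_mk_eq_of_homotopy _ _ ⟨fun z => F (z.2.2, (z.2.1, z.1)), by fun_prop⟩
    (fun y => by simp [hA, conjLoop]) (fun y => by simp [hB, conjLoop])
    (fun s => ⟨fun x => by simp [hend], fun x => by simp [hend]⟩)).symm

/-- For trivial clutching the null classes are only `1` and the class of `η`, so membership leaves
two possible values for `conjClass g η`. -/
lemma isTurnableTwist_iff
    (hη : ∀ B : Path (1 : G) 1, B.Homotopic (Path.refl 1) ∨ B.Homotopic η)
    (hη2 : (η.trans η).Homotopic (Path.refl 1)) (g : C(X, G)) :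
    IsTurnableTwist g η ↔ conjLoop g η ∈ nullClasses (1 : C(X, G)) := by
  refine ⟨fun h => ?_, fun h => isTurnableTwist_of_conjClass_eq ?_⟩
  · exact mem_nullClasses_of_mk_eq (f := conjLoop 1 η) (conjClass_eq_of_isTurnableTwist h).symm
      (conjLoop_mem 1 η)
  · obtain ⟨A, B, hAB⟩ := (mem_nullClasses_iff _ _).1 h
    have h2 : conjClass (1 : C(X, G)) η * conjClass (1 : C(X, G)) η = 1 := by
      rw [← conjClass_trans, conjClass_congr _ hη2, conjClass_refl]
    have h3 : conjClass g η = 1 ∨ conjClass g η = conjClass 1 η := by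
      change conjClass g η = _ at hAB
      rcases hη A with hA | hA <;> rcases hη B with hB | hB <;>
        rw [conjClass_congr _ hA, conjClass_congr _ hB] at hAB <;> simp [hAB, h2]
    rcases h3 with h3 | h3
    -- If `conjClass g η` is trivial, restriction to `{x₀} × I` shows that `η` itself is
    -- null-homotopic, so `conjClass 1 η` is trivial as well.
    · obtain ⟨x₀⟩ := ‹Nonempty X›
      have h4 : η.Homotopic (Path.refl 1) := by
        rw [eq_comm, ← QuotientGroup.mk_one, conjClass, QuotientGroup.eq] at h3
        obtain ⟨F, h0, h1, hF⟩ := h3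
        have : (conjPath (g x₀) η).Homotopic (Path.refl 1) := by
          refine Path.Homotopic.symm (homotopic_of_square
            ⟨fun z => F (z.1, (x₀, z.2)), by fun_prop⟩ ?_ ?_ ?_ ?_)
          · intro t; simp [h0]
          · intro t; simp [h1]
          · exact fun s => (hF s).1 x₀
          · exact fun s => (hF s).2 x₀
        exact (conjPath_homotopic (g x₀) η).symm.trans this
      rw [h3, conjClass_congr _ h4, conjClass_refl]
    · exact h3

/-- `nullClasses 1` has index at most two in `nullClasses g`, the only possible further coset being
that of `conjLoop g η`; whether this coset is new is decided by `isTurnableTwist_iff`. -/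
theorem card_twistedMaps
    (hη : ∀ B : Path (1 : G) 1, B.Homotopic (Path.refl 1) ∨ B.Homotopic η)
    (hη2 : (η.trans η).Homotopic (Path.refl 1)) (g : C(X, G)) :
    (IsTurnableTwist g η →
      Nat.card (twistedMaps g ⧸ (nullHomotopicIn (twistedMaps g)).subgroupOf (twistedMaps g)) =
      Nat.card (twistedMaps (1 : C(X, G)) ⧸
        (nullHomotopicIn (twistedMaps (1 : C(X, G)))).subgroupOf (twistedMaps 1))) ∧
    (¬ IsTurnableTwist g η →
      2 * Nat.card (twistedMaps g ⧸ (nullHomotopicIn (twistedMaps g)).subgroupOf (twistedMaps g)) =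
      Nat.card (twistedMaps (1 : C(X, G)) ⧸
        (nullHomotopicIn (twistedMaps (1 : C(X, G)))).subgroupOf (twistedMaps 1))) := by
  rw [isTurnableTwist_iff hη hη2, ← index_nullClasses, ← index_nullClasses]
  have hle : nullClasses (1 : C(X, G)) ≤ nullClasses g := by
    intro f hf
    obtain ⟨A, B, hAB⟩ := (mem_nullClasses_iff _ _).1 hf
    exact mem_nullClasses_of_mk_eq (f := conjLoop 1 A * conjLoop 1 B) hAB.symm
      (mul_mem (conjLoop_one_mem g A) (conjLoop_one_mem g B))
  have key : ∀ f ∈ nullClasses g, f ∈ nullClasses (1 : C(X, G)) ∨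
      f * conjLoop g η ∈ nullClasses (1 : C(X, G)) := by
    intro f hf
    obtain ⟨A, B, hAB⟩ := (mem_nullClasses_iff _ _).1 hf
    rcases hη B with hB | hB
    · left
      rw [conjClass_congr _ hB, conjClass_refl, mul_one] at hAB
      exact mem_nullClasses_of_mk_eq hAB.symm (conjLoop_mem 1 A)
    · right
      refine mem_nullClasses_of_mk_eq (f := conjLoop 1 A) ?_ (conjLoop_mem 1 A)
      rw [QuotientGroup.mk_mul, hAB, mul_assoc]
      change _ = _ * (_ * conjClass g η)
      rw [conjClass_congr _ hB, ← conjClass_trans, conjClass_congr _ hη2, conjClass_refl, mul_one]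
      rfl
  constructor
  · intro h
    rw [le_antisymm hle]
    intro f hf
    rcases key f hf with h' | h'
    · exact h'
    · simpa using mul_mem h' (inv_mem h)
  · intro h
    rw [← Subgroup.relIndex_mul_index hle]
    congr 1
    symm
    rw [Subgroup.relIndex_eq_two_iff]
    refine ⟨conjLoop g η, conjLoop_mem g η, fun b hb => ?_⟩
    by_cases hb' : b ∈ nullClasses (1 : C(X, G))
    · exact Or.inr ⟨hb', fun h' => h (by simpa using mul_mem (inv_mem hb') h')⟩
    · exact Or.inl ⟨(key b hb).resolve_left hb', hb'⟩

end TwistedMaps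

/-! ### The covering homotopy theorem for principal bundles. -/

section PrincipalBundle

/-- A principal `G`-bundle `P → B`, with the right action of `G` on `P` and the map that sends two
points of the same fibre to the element of `G` by which they differ. -/
structure PrincipalBundle (P B G : Type*) [TopologicalSpace P] [TopologicalSpace B]
    [TopologicalSpace G] where
  /-- the projection -/
  proj : P → B
  /-- the action -/
  act : P → G → P
  /-- the difference of two points of a fibre -/
  diff : P → P → G
  continuous_proj : Continuous proj
  continuous_act : Continuous fun z : P × G => act z.1 z.2
  continuousOn_diff : ContinuousOn (fun z : P × P => diff z.1 z.2) {z | proj z.1 = proj z.2}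
  proj_act : ∀ p a, proj (act p a) = proj p
  act_diff : ∀ p p', proj p = proj p' → act p (diff p p') = p'
  exists_section : ∀ b, ∃ U, IsOpen U ∧ b ∈ U ∧ ∃ s : B → P, ContinuousOn s U ∧
    ∀ c ∈ U, proj (s c) = c

namespace PrincipalBundle

variable {P B G X : Type*} [TopologicalSpace P] [TopologicalSpace B] [TopologicalSpace G]
  [TopologicalSpace X] (Q : PrincipalBundle P B G)

lemma continuousOn_transport {Y : Type*} [TopologicalSpace Y] {a b p : Y → P} {S : Set Y}
    (ha : ContinuousOn a S) (hb : ContinuousOn b S) (hp : ContinuousOn p S)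
    (h : ∀ y ∈ S, Q.proj (a y) = Q.proj (p y)) :
    ContinuousOn (fun y => Q.act (b y) (Q.diff (a y) (p y))) S := by
  have h1 : ContinuousOn (fun y => Q.diff (a y) (p y)) S :=
    Q.continuousOn_diff.comp (ha.prodMk hp) h
  exact Q.continuous_act.comp_continuousOn (hb.prodMk h1)

/-- Subdivide `I` so that each piece of `{x₀} × I` is mapped into the domain of one local section;
the tube lemma thickens the pieces, and the lift is extended over them one at a time. -/
lemma exists_partial_lift (f : C(X × I, B)) (x₀ : X) : ∃ U, IsOpen U ∧ x₀ ∈ U ∧ ∃ e : X × I → P,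
    ContinuousOn e (U ×ˢ Set.univ) ∧ ∀ x ∈ U, ∀ t, Q.proj (e (x, t)) = f (x, t) := by
  choose V hVo hV s hs hsV using Q.exists_section
  obtain ⟨t, ht0, htm, ⟨N, hN⟩, ht⟩ := exists_monotone_Icc_subset_open_cover_unitInterval
    (c := fun b : B => {t | f (x₀, t) ∈ V b})
    (fun b => (hVo b).preimage (by fun_prop))
    (fun t _ => Set.mem_iUnion.2 ⟨f (x₀, t), hV _⟩)
  have key : ∀ n, ∃ U, IsOpen U ∧ x₀ ∈ U ∧ ∃ e : X × I → P,
      ContinuousOn e (U ×ˢ Set.Iic (t n)) ∧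
      ∀ x ∈ U, ∀ r ≤ t n, Q.proj (e (x, r)) = f (x, r) := by
    intro n
    induction n with
    | zero =>
      refine ⟨{x | f (x, 0) ∈ V (f (x₀, 0))}, (hVo _).preimage (by fun_prop), hV _,
        fun z => s (f (x₀, 0)) (f (z.1, 0)), ?_, ?_⟩
      · exact (hs _).comp (Continuous.continuousOn (by fun_prop)) fun z hz => hz.1
      · intro x hx r hr
        rw [ht0] at hr
        obtain rfl : r = 0 := le_antisymm hr bot_le
        exact hsV _ _ hx
    | succ n ih =>
      obtain ⟨U, hU, hx₀, e, he, hp⟩ := ih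
      obtain ⟨b, hb⟩ := ht n
      obtain ⟨U', W, hU', -, hxU', hW, hsub⟩ := generalized_tube_lemma
        (s := {x₀}) isCompact_singleton (isCompact_Icc (a := t n) (b := t (n + 1)))
        (n := f ⁻¹' V b) ((hVo b).preimage f.continuous) (by
          rintro ⟨x, r⟩ ⟨hx, hr⟩
          obtain rfl : x = x₀ := hx
          exact hb hr)
      have hmem : ∀ x ∈ U', ∀ r, t n ≤ r → r ≤ t (n + 1) → f (x, r) ∈ V b := fun x hx r h1 h2 =>
        hsub ⟨hx, hW ⟨h1, h2⟩⟩
      have hle := htm n.le_succ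
      -- On the new piece follow the section `s b`, translated by the group element that makes it
      -- agree with `e` at time `t n`.
      refine ⟨U ∩ U', hU.inter hU', ⟨hx₀, hxU' rfl⟩, fun z => if z.2 ≤ t n then e z else
        Q.act (s b (f z)) (Q.diff (s b (f (z.1, t n))) (e (z.1, t n))), ?_, ?_⟩
      · refine ContinuousOn.if ?_ ?_ ?_
        · rintro ⟨x, r⟩ ⟨⟨⟨hx, hx'⟩, hr⟩, hfr⟩
          obtain rfl : r = t n := frontier_le_subset_eq continuous_snd continuous_const hfr
          refine (Q.act_diff _ _ ?_).symm
          rw [hsV b _ (hmem x hx' _ le_rfl hle), hp x hx _ le_rfl]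
        · rw [(isClosed_le continuous_snd continuous_const).closure_eq]
          exact he.mono fun z hz => ⟨hz.1.1.1, hz.2⟩
        · have hcl : ∀ z ∈ ((U ∩ U') ×ˢ Set.Iic (t (n + 1))) ∩ closure {z : X × I | ¬ z.2 ≤ t n},
              t n ≤ z.2 := by
            rintro z ⟨-, hz⟩
            refine closure_minimal (t := {z : X × I | t n ≤ z.2}) ?_
              (isClosed_le continuous_const continuous_snd) hz
            intro z hz
            exact (not_le.1 hz).le
          refine Q.continuousOn_transport ?_ ?_ ?_ ?_
          · exact (hs b).comp (Continuous.continuousOn (by fun_prop))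
              fun z hz => hmem _ hz.1.1.2 _ le_rfl hle
          · exact (hs b).comp (Continuous.continuousOn (by fun_prop))
              fun z hz => hmem _ hz.1.1.2 _ (hcl z hz) hz.1.2
          · exact he.comp (Continuous.continuousOn (by fun_prop))
              fun z hz => ⟨hz.1.1.1, le_refl (t n)⟩
          · intro z hz
            rw [hsV b _ (hmem _ hz.1.1.2 _ le_rfl hle), hp _ hz.1.1.1 _ le_rfl]
      · rintro x ⟨hx, hx'⟩ r hr
        dsimp only
        split_ifs with h
        · exact hp x hx r h
        · rw [Q.proj_act, hsV b _ (hmem x hx' r (not_le.1 h).le hr)]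
  obtain ⟨U, hU, hx, e, he, hp⟩ := key N
  refine ⟨U, hU, hx, e, ?_, fun x hx t => hp x hx t (by rw [hN N le_rfl]; exact le_top)⟩
  have : Set.Iic (t N) = Set.univ := by
    rw [hN N le_rfl]; exact Set.Iic_top
  rwa [this] at he

open Classical in
/-- Start from the lift `φ` of `f` over `X × {0}`, and transport it successively along the
local lifts `e i`, for `i` in a list read from the right, for a time `ρ i x` each, and at most
until the time `t`. -/
noncomputable def transport {ι : Type*} (ρ : ι → X → ℝ) (U : ι → Set X) (e : ι → X × I → P)
    (φ : X → P) : List ι → X × I → P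
  | [], z => φ z.1
  | i :: l, z => if z.1 ∈ U i then
      Q.act (e i (z.1, Set.projIcc 0 1 zero_le_one (min z.2.1 ((i :: l).map (ρ · z.1)).sum)))
        (Q.diff (e i (z.1, Set.projIcc 0 1 zero_le_one (min z.2.1 (l.map (ρ · z.1)).sum)))
          (transport ρ U e φ l z))
    else transport ρ U e φ l z

section Transport

variable {Q} {ι : Type*} {ρ : ι → X → ℝ} {U : ι → Set X} {e : ι → X × I → P}
  {φ : X → P} {f : C(X × I, B)}

/-- The partial sum of weights is the time reached so far; a step skipped outside `U i` has weight
zero and loses no time. -/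
lemma proj_transport (hρU : ∀ i x, x ∉ U i → ρ i x = 0)
    (he : ∀ i, ∀ x ∈ U i, ∀ t, Q.proj (e i (x, t)) = f (x, t)) (hφ : ∀ x, Q.proj (φ x) = f (x, 0))
    (l : List ι) (z : X × I) : Q.proj (Q.transport ρ U e φ l z) =
      f (z.1, Set.projIcc 0 1 zero_le_one (min z.2.1 (l.map (ρ · z.1)).sum)) := by
  induction l with
  | nil =>
    simp [transport, hφ, z.2.2.1]
  | cons i l ih =>
    rw [transport]
    split_ifs with h
    · rw [Q.proj_act, he i _ h]
    · rw [ih]; simp [hρU i _ h]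

lemma transport_cons_of_eq_zero (hρU : ∀ i x, x ∉ U i → ρ i x = 0)
    (he : ∀ i, ∀ x ∈ U i, ∀ t, Q.proj (e i (x, t)) = f (x, t)) (hφ : ∀ x, Q.proj (φ x) = f (x, 0))
    (i : ι) (l : List ι) (z : X × I) (h : ρ i z.1 = 0) :
    Q.transport ρ U e φ (i :: l) z = Q.transport ρ U e φ l z := by
  rw [transport]
  split_ifs with hz
  · rw [List.map_cons, List.sum_cons, h, zero_add]
    refine Q.act_diff _ _ ?_
    rw [he i _ hz, proj_transport hρU he hφ]
  · rfl

open Classical in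
-- Indices of weight zero can be dropped. This allows the point-dependent list of active indices to
-- be replaced, near a given point, by one fixed finite list.
lemma transport_filter (hρU : ∀ i x, x ∉ U i → ρ i x = 0)
    (he : ∀ i, ∀ x ∈ U i, ∀ t, Q.proj (e i (x, t)) = f (x, t)) (hφ : ∀ x, Q.proj (φ x) = f (x, 0))
    (l : List ι) (z : X × I) :
    Q.transport ρ U e φ (l.filter fun i => ρ i z.1 ≠ 0) z = Q.transport ρ U e φ l z := by
  induction l with
  | nil => rfl
  | cons i l ih =>
    by_cases h : ρ i z.1 = 0
    · rw [transport_cons_of_eq_zero hρU he hφ i l z h, ← ih, List.filter_cons_of_neg (by simpa)]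
    · rw [List.filter_cons_of_pos (by simpa)]
      have hs : ((l.filter fun i => ρ i z.1 ≠ 0).map (ρ · z.1)).sum = (l.map (ρ · z.1)).sum := by
        clear ih
        induction l with
        | nil => rfl
        | cons j l ih =>
          by_cases hj : ρ j z.1 = 0
          · rw [List.filter_cons_of_neg (by simpa), ih]; simp [hj]
          · rw [List.filter_cons_of_pos (by simpa), List.map_cons, List.sum_cons, ih]; simp
      simp only [transport, List.map_cons, List.sum_cons, hs, ih]

lemma transport_zero (hρ : ∀ i x, 0 ≤ ρ i x)
    (he : ∀ i, ∀ x ∈ U i, ∀ t, Q.proj (e i (x, t)) = f (x, t)) (hφ : ∀ x, Q.proj (φ x) = f (x, 0))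
    (l : List ι) (x : X) : Q.transport ρ U e φ l (x, 0) = φ x := by
  induction l with
  | nil => rfl
  | cons i l ih =>
    rw [transport]
    have h1 : ∀ l : List ι, min ((0 : I) : ℝ) (l.map (ρ · x)).sum = 0 := fun l =>
      min_eq_left (List.sum_nonneg (by simp [hρ]))
    split_ifs with hz
    · simp only [h1] at *
      rw [ih]
      refine Q.act_diff _ _ ?_
      rw [he i _ hz, hφ]; simp
    · exact ih

/-- `U i` and the complement of the closed support of `ρ i` form an open cover: on the first the
transport formula applies, on the second the step is trivial. -/
lemma continuous_transport (hρc : ∀ i, Continuous (ρ i)) (hU : ∀ i, IsOpen (U i))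
    (hρ : ∀ i, tsupport (ρ i) ⊆ U i) (hφc : Continuous φ)
    (hec : ∀ i, ContinuousOn (e i) (U i ×ˢ Set.univ))
    (he : ∀ i, ∀ x ∈ U i, ∀ t, Q.proj (e i (x, t)) = f (x, t)) (hφ : ∀ x, Q.proj (φ x) = f (x, 0))
    (l : List ι) : Continuous (Q.transport ρ U e φ l) := by
  have hρU : ∀ i x, x ∉ U i → ρ i x = 0 := fun i x hx =>
    image_eq_zero_of_notMem_tsupport fun h => hx (hρ i h)
  induction l with
  | nil => exact hφc.comp continuous_fst
  | cons i l ih =>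
    rw [continuous_iff_continuousAt]
    rintro ⟨x, t⟩
    have hsum : ∀ l : List ι, Continuous fun z : X × I =>
        (z.1, Set.projIcc 0 1 (zero_le_one (α := ℝ)) (min z.2.1 (l.map (ρ · z.1)).sum)) := by
      intro l
      have : Continuous fun x => (l.map (ρ · x)).sum := by
        induction l with
        | nil => exact continuous_const
        | cons j l ih =>
          simp only [List.map_cons, List.sum_cons]
          exact (hρc j).add ih
      exact continuous_fst.prodMk (continuous_projIcc.comp
        ((continuous_subtype_val.comp continuous_snd).min (this.comp continuous_fst)))
    by_cases hx : x ∈ U i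
    · have ho : U i ×ˢ Set.univ ∈ 𝓝 (x, t) := ((hU i).prod isOpen_univ).mem_nhds ⟨hx, trivial⟩
      refine ContinuousAt.congr (f := fun z => Q.act (e i (z.1, Set.projIcc 0 1 zero_le_one
        (min z.2.1 ((i :: l).map (ρ · z.1)).sum))) (Q.diff (e i (z.1, Set.projIcc 0 1 zero_le_one
        (min z.2.1 (l.map (ρ · z.1)).sum))) (Q.transport ρ U e φ l z))) ?_ ?_
      · refine ContinuousOn.continuousAt (Q.continuousOn_transport ?_ ?_ ih.continuousOn ?_) ho
        · exact (hec i).comp (hsum l).continuousOn fun z hz => ⟨hz.1, trivial⟩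
        · exact (hec i).comp (hsum (i :: l)).continuousOn fun z hz => ⟨hz.1, trivial⟩
        · intro z hz
          rw [he i _ hz.1, proj_transport hρU he hφ]
      · filter_upwards [ho] with z hz
        simp only [transport, if_pos hz.1]
    · have ho : (tsupport (ρ i))ᶜ ×ˢ Set.univ ∈ 𝓝 (x, t) :=
        ((isClosed_tsupport _).isOpen_compl.prod isOpen_univ).mem_nhds
          ⟨fun h => hx (hρ i h), trivial⟩
      refine ih.continuousAt.congr ?_
      filter_upwards [ho] with z hz
      exact (transport_cons_of_eq_zero hρU he hφ i l z (image_eq_zero_of_notMem_tsupport hz.1)).symm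

end Transport

/-- The covering homotopy theorem for principal bundles over paracompact spaces. -/
theorem exists_lift [T2Space X] [ParacompactSpace X] (f : C(X × I, B)) (φ : C(X, P))
    (hφ : ∀ x, Q.proj (φ x) = f (x, 0)) :
    ∃ Φ : C(X × I, P), (∀ z, Q.proj (Φ z) = f z) ∧ ∀ x, Φ (x, 0) = φ x := by
  classical
  choose U hU hxU e hec he using fun x₀ => Q.exists_partial_lift f x₀
  obtain ⟨ρ, hρ⟩ := PartitionOfUnity.exists_isSubordinate isClosed_univ U hU
    (fun x _ => Set.mem_iUnion.2 ⟨x, hxU x⟩)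
  -- Any linear order will do. It only ensures that the local lifts are used in a compatible order
  -- at different points.
  obtain ⟨r⟩ : Nonempty (LinearOrder X) := ⟨linearOrderOfSTO WellOrderingRel⟩
  let ρ' : X → X → ℝ := fun i => ρ i
  have hρU : ∀ i x, x ∉ U i → ρ' i x = 0 := fun i x hx =>
    image_eq_zero_of_notMem_tsupport fun h => hx (hρ i h)
  let Φ : X × I → P := fun z => Q.transport ρ' U e φ ((ρ.finsupport z.1).sort (· ≤ ·)) z
  have hsort : ∀ (F : Finset X) (z : X × I), (∀ i, ρ i z.1 ≠ 0 → i ∈ F) →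
      Φ z = Q.transport ρ' U e φ (F.sort (· ≤ ·)) z := by
    intro F z hF
    rw [← transport_filter hρU he hφ (F.sort (· ≤ ·))]
    have : (ρ.finsupport z.1).sort (· ≤ ·) =
        (F.sort (· ≤ ·)).filter fun i => ρ' i z.1 ≠ 0 := by
      refine List.Perm.eq_of_pairwise' (r := (· ≤ ·)) (Finset.pairwise_sort _ _)
        ((Finset.pairwise_sort F (· ≤ ·)).filter _) ?_
      rw [List.perm_ext_iff_of_nodup (Finset.sort_nodup _ _) ((Finset.sort_nodup _ _).filter _)]
      intro i
      simp only [Finset.mem_sort, List.mem_filter, decide_eq_true_eq, PartitionOfUnity.mem_finsupport]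
      exact ⟨fun h => ⟨hF i h, h⟩, fun h => h.2⟩
    simp only [Φ, this]
  have hΦ : Continuous Φ := by
    rw [continuous_iff_continuousAt]
    rintro ⟨x, t⟩
    obtain ⟨V, hV, hfin⟩ := ρ.locallyFinite x
    have hc : Continuous (Q.transport ρ' U e φ (hfin.toFinset.sort (· ≤ ·))) :=
      continuous_transport (fun i => (ρ i).continuous) hU hρ φ.continuous hec he hφ _
    refine hc.continuousAt.congr ?_
    have ho : V ×ˢ Set.univ ∈ 𝓝 (x, t) := prod_mem_nhds hV Filter.univ_mem
    filter_upwards [ho] with z hz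
    refine (hsort _ z fun i hi => ?_).symm
    rw [Set.Finite.mem_toFinset]
    exact ⟨z.1, hi, hz.1⟩
  refine ⟨⟨Φ, hΦ⟩, fun z => ?_, fun x => transport_zero (fun i x => ρ.nonneg i x) he hφ _ _⟩
  change Q.proj (Q.transport _ _ _ _ _ _) = _
  rw [proj_transport hρU he hφ]
  -- The weights sum to one, so the truncated time `min t 1` is `t` and the transport lies over `f
  -- z`.
  have hs : (((ρ.finsupport z.1).sort (· ≤ ·)).map (ρ' · z.1)).sum = 1 := by
    rw [← ρ.sum_finsupport (x₀ := z.1) trivial, ← Finset.sum_map_toList]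
    exact ((Finset.sort_perm_toList _ _).map _).sum_eq
  rw [hs, min_eq_left z.2.2.2]
  simp

end PrincipalBundle

end PrincipalBundle

/-! ### Reflections, and path connectedness of `SO n`. -/

section SpecialOrthogonal

open Matrix

variable {n : ℕ}

instance SO.isTopologicalGroup (n : ℕ) : IsTopologicalGroup (SO n) where
  continuous_inv := Continuous.subtype_mk continuous_subtype_val.matrix_transpose _

lemma SO.transpose_mul (A : SO n) : A.1ᵀ * A.1 = 1 :=
  (mem_orthogonalGroup_iff' (Fin n) ℝ).1 (mem_specialOrthogonalGroup_iff.1 A.2).1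

lemma SO.det_eq (A : SO n) : A.1.det = 1 := (mem_specialOrthogonalGroup_iff.1 A.2).2

lemma SO.mem_of {A : Matrix (Fin n) (Fin n) ℝ} (h : Aᵀ * A = 1) (h' : A.det = 1) :
    A ∈ specialOrthogonalGroup (Fin n) ℝ :=
  mem_specialOrthogonalGroup_iff.2 ⟨(mem_orthogonalGroup_iff' (Fin n) ℝ).2 h, h'⟩

lemma SO.mulVec_dotProduct (A : SO n) (x y : Fin n → ℝ) :
    (A.1 *ᵥ x) ⬝ᵥ (A.1 *ᵥ y) = x ⬝ᵥ y := by
  rw [dotProduct_mulVec, vecMul_mulVec, SO.transpose_mul A, vecMul_one]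

@[simp] lemma SO.coe_mul_mulVec (A B : SO n) (x : Fin n → ℝ) :
    (A * B).1 *ᵥ x = A.1 *ᵥ (B.1 *ᵥ x) := (mulVec_mulVec _ _ _).symm

@[simp] lemma SO.coe_one : (1 : SO n).1 = 1 := rfl

lemma SO.inv_mulVec_eq_iff (A : SO n) (x y : Fin n → ℝ) :
    (A⁻¹).1 *ᵥ x = y ↔ x = A.1 *ᵥ y := by
  constructor
  · rintro rfl
    rw [← SO.coe_mul_mulVec, mul_inv_cancel, SO.coe_one, one_mulVec]
  · rintro rfl
    rw [← SO.coe_mul_mulVec, inv_mul_cancel, SO.coe_one, one_mulVec]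

/-- The reflection in the hyperplane orthogonal to `u`. -/
noncomputable def householder (u : Fin n → ℝ) : Matrix (Fin n) (Fin n) ℝ :=
  1 - (2 / (u ⬝ᵥ u)) • vecMulVec u u

lemma householder_mulVec (u x : Fin n → ℝ) :
    householder u *ᵥ x = x - (2 / (u ⬝ᵥ u) * (u ⬝ᵥ x)) • u := by
  rw [householder, sub_mulVec, one_mulVec, smul_mulVec, vecMulVec_mulVec, mul_smul,
    op_smul_eq_smul]

lemma dotProduct_self_ne_zero {u : Fin n → ℝ} (hu : u ≠ 0) : u ⬝ᵥ u ≠ 0 :=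
  fun h => hu (dotProduct_self_eq_zero.1 h)

lemma householder_mul_self {u : Fin n → ℝ} (hu : u ≠ 0) : householder u * householder u = 1 := by
  have := dotProduct_self_ne_zero hu
  refine Matrix.ext_iff_mulVec.2 fun x => ?_
  rw [← mulVec_mulVec, householder_mulVec, householder_mulVec, one_mulVec, dotProduct_sub,
    dotProduct_smul, sub_sub, ← add_smul, smul_eq_mul]
  convert sub_zero x
  convert zero_smul ℝ u
  field_simp
  ring

lemma householder_transpose (u : Fin n → ℝ) : (householder u)ᵀ = householder u := by
  rw [householder, transpose_sub, transpose_one, transpose_smul, transpose_vecMulVec]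

lemma householder_det {u : Fin n → ℝ} (hu : u ≠ 0) : (householder u).det = -1 := by
  have := dotProduct_self_ne_zero hu
  -- A rank-one perturbation of the identity, whose determinant is `1 - 2`.
  have h : householder u = 1 + replicateCol Unit ((-(2 / (u ⬝ᵥ u))) • u) * replicateRow Unit u := by
    ext i j
    simp [householder, vecMulVec_apply, Matrix.mul_apply, Matrix.one_apply]
    ring
  rw [h, det_one_add_replicateCol_mul_replicateRow, dotProduct_smul, smul_eq_mul]
  field_simp
  ring

lemma householder_apply_of_orthogonal {u x : Fin n → ℝ} (h : u ⬝ᵥ x = 0) :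
    householder u *ᵥ x = x := by
  rw [householder_mulVec, h]; simp

lemma householder_sub_mulVec {a b : Fin n → ℝ} (hab : a - b ≠ 0) (h : a ⬝ᵥ a = b ⬝ᵥ b) :
    householder (a - b) *ᵥ a = b := by
  have h0 := dotProduct_self_ne_zero hab
  rw [householder_mulVec]
  have : 2 / ((a - b) ⬝ᵥ (a - b)) * ((a - b) ⬝ᵥ a) = 1 := by
    field_simp
    simp only [sub_dotProduct, dotProduct_sub, dotProduct_comm b a]
    linarith
  rw [this, one_smul, sub_sub_cancel]

lemma householder_add_mulVec {a b : Fin n → ℝ} (hab : a + b ≠ 0) (h : a ⬝ᵥ a = b ⬝ᵥ b) :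
    householder (a + b) *ᵥ a = -b := by
  have := householder_sub_mulVec (a := a) (b := -b) (by simpa using hab) (by simpa using h)
  simpa using this

lemma householder_self_mulVec {u : Fin n → ℝ} (hu : u ≠ 0) : householder u *ᵥ u = -u := by
  rw [householder_mulVec, div_mul_cancel₀ _ (dotProduct_self_ne_zero hu)]
  rw [two_smul]; abel

/-- The product of two reflections. -/
noncomputable def twoReflections (u w : Fin n → ℝ) (hu : u ≠ 0) (hw : w ≠ 0) : SO n :=
  ⟨householder u * householder w, SO.mem_of
    (by rw [transpose_mul, householder_transpose, householder_transpose, Matrix.mul_assoc,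
          ← Matrix.mul_assoc (householder u), householder_mul_self hu, Matrix.one_mul,
          householder_mul_self hw])
    (by rw [det_mul, householder_det hu, householder_det hw]; norm_num)⟩

lemma twoReflections_mulVec (u w : Fin n → ℝ) (hu : u ≠ 0) (hw : w ≠ 0) (x : Fin n → ℝ) :
    (twoReflections u w hu hw).1 *ᵥ x = householder u *ᵥ (householder w *ᵥ x) :=
  (mulVec_mulVec _ _ _).symm

@[simp] lemma twoReflections_self (u : Fin n → ℝ) (hu hu' : u ≠ 0) : twoReflections u u hu hu' = 1 :=
  Subtype.ext (householder_mul_self hu)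

lemma continuous_householder {Y : Type*} [TopologicalSpace Y] {u : Y → Fin n → ℝ}
    (hu : Continuous u) (h : ∀ y, u y ≠ 0) : Continuous fun y => householder (u y) := by
  have h1 : Continuous fun y => u y ⬝ᵥ u y := hu.dotProduct hu
  have h2 : Continuous fun y => 2 / (u y ⬝ᵥ u y) :=
    continuous_const.div h1 fun y => dotProduct_self_ne_zero (h y)
  exact continuous_const.sub (h2.smul (hu.matrix_vecMulVec hu))

lemma continuous_twoReflections {Y : Type*} [TopologicalSpace Y] {u w : Y → Fin n → ℝ}
    (hu : Continuous u) (hw : Continuous w) (h : ∀ y, u y ≠ 0) (h' : ∀ y, w y ≠ 0) :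
    Continuous fun y => twoReflections (u y) (w y) (h y) (h' y) :=
  Continuous.subtype_mk ((continuous_householder hu h).matrix_mul (continuous_householder hw h')) _

/-- The matrix `A` fixes the standard basis vectors with index in `S`. -/
def FixesBasis (S : Finset (Fin n)) (A : SO n) : Prop :=
  ∀ i ∈ S, A.1 *ᵥ Pi.single i 1 = Pi.single i 1

lemma FixesBasis.mul {S : Finset (Fin n)} {A B : SO n} (hA : FixesBasis S A)
    (hB : FixesBasis S B) : FixesBasis S (A * B) := fun i hi => by
  rw [SO.coe_mul_mulVec, hB i hi, hA i hi]

lemma FixesBasis.inv {S : Finset (Fin n)} {A : SO n} (hA : FixesBasis S A) :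
    FixesBasis S A⁻¹ := fun i hi => by
  rw [SO.inv_mulVec_eq_iff, hA i hi]

lemma FixesBasis.mulVec_apply {S : Finset (Fin n)} {A : SO n} (hA : FixesBasis S A) {i : Fin n}
    (hi : i ∈ S) (x : Fin n → ℝ) : (A.1 *ᵥ x) i = x i := by
  have := SO.mulVec_dotProduct A (Pi.single i 1) x
  rw [hA i hi] at this
  simpa using this

lemma fixesBasis_twoReflections {S : Finset (Fin n)} {u w : Fin n → ℝ} (hu : u ≠ 0) (hw : w ≠ 0)
    (hu' : ∀ i ∈ S, u i = 0) (hw' : ∀ i ∈ S, w i = 0) : FixesBasis S (twoReflections u w hu hw) := by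
  intro i hi
  have h : householder w *ᵥ Pi.single i 1 = Pi.single i 1 :=
    householder_apply_of_orthogonal (by simp [hw' i hi])
  rw [twoReflections_mulVec, h, householder_apply_of_orthogonal (by simp [hu' i hi])]

/-- Orthogonality makes the rows as well as the columns outside `j` trivial, and the one remaining
diagonal entry equals the determinant. -/
lemma eq_one_of_fixesBasis {j : Fin n} {S : Finset (Fin n)} (hS : ∀ i, i ≠ j → i ∈ S) {A : SO n}
    (hA : FixesBasis S A) : A = 1 := by
  have hcol : ∀ i k, i ≠ j → A.1 i k = (1 : Matrix (Fin n) (Fin n) ℝ) i k := by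
    intro i k hi
    have := hA.mulVec_apply (hS i hi) (Pi.single k 1)
    simpa [Matrix.one_apply, Pi.single_apply, eq_comm] using this
  have hrow : ∀ i k, k ≠ j → A.1 i k = (1 : Matrix (Fin n) (Fin n) ℝ) i k := by
    intro i k hk
    have := congrFun (hA k (hS k hk)) i
    simpa [Matrix.one_apply, Pi.single_apply] using this
  have hd : A.1 = diagonal (Function.update 1 j (A.1 j j)) := by
    ext i k
    by_cases hi : i = j
    · by_cases hk : k = j
      · subst hi; subst hk; simp
      · rw [hrow i k hk, hi, Matrix.one_apply_ne (Ne.symm hk), diagonal_apply_ne _ (Ne.symm hk)]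
    · rw [hcol i k hi, Matrix.one_apply, diagonal_apply, Function.update_of_ne hi]; rfl
  have hdet := SO.det_eq A
  rw [hd, det_diagonal, Finset.prod_update_of_mem (Finset.mem_univ _)] at hdet
  have hj : A.1 j j = 1 := by simpa using hdet
  refine Subtype.ext ?_
  rw [hd, hj]
  simp

lemma exists_path_ne_zero (hn : 2 ≤ n) {u w : Fin n → ℝ} (hu : u ≠ 0) (hw : w ≠ 0) :
    ∃ p : Path u w, ∀ t, p t ≠ 0 := by
  have h := isPathConnected_compl_singleton_of_one_lt_rank (E := Fin n → ℝ) (by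
    rw [rank_fin_fun]; exact_mod_cast hn) 0
  obtain ⟨p, hp⟩ := h.joinedIn u hu w hw
  exact ⟨p, hp⟩

/-- Move one normal vector to the other through nonzero vectors; when they coincide the product is
`1`. -/
lemma joined_one_twoReflections (hn : 2 ≤ n) {u w : Fin n → ℝ} (hu : u ≠ 0) (hw : w ≠ 0) :
    Joined 1 (twoReflections u w hu hw) := by
  obtain ⟨p, hp⟩ := exists_path_ne_zero hn hw hu
  exact ⟨{ toFun := fun t => twoReflections (p t) w (hp t) hw
           continuous_toFun := continuous_twoReflections p.continuous continuous_const _ _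
           source' := by simp
           target' := by simp }⟩

/-- Induction on the number of directions not yet fixed, of which there are at most `m + 1`. A
product of two reflections, itself joined to `1`, makes one more basis vector fixed. -/
lemma joined_one_of_fixesBasis (hn : 2 ≤ n) (m : ℕ) : ∀ (S : Finset (Fin n)) (A : SO n),
    n ≤ S.card + m + 1 → FixesBasis S A → Joined 1 A := by
  induction m with
  | zero =>
    intro S A hS hA
    suffices A = 1 by rw [this]
    by_cases h : ∃ j, j ∉ S
    · obtain ⟨j, hj⟩ := h
      refine eq_one_of_fixesBasis (j := j) (S := S) (fun i hi => ?_) hA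
      by_contra hi'
      have h2 : ({i, j} : Finset (Fin n)) ⊆ Sᶜ := by
        intro k hk
        simp only [Finset.mem_insert, Finset.mem_singleton] at hk
        rcases hk with rfl | rfl <;> simpa
      have := Finset.card_le_card h2
      rw [Finset.card_pair hi, Finset.card_compl, Fintype.card_fin] at this
      omega
    · push Not at h
      exact eq_one_of_fixesBasis (j := ⟨0, by omega⟩) (S := S) (fun i _ => h i) hA
  | succ m ih =>
    intro S A hS hA
    by_cases hc : n ≤ S.card + 1
    · exact ih S A (by omega) hA
    obtain ⟨j, hj⟩ : ∃ j, j ∉ S := by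
      by_contra! h
      have := Finset.eq_univ_iff_forall.2 h
      rw [this, Finset.card_univ, Fintype.card_fin] at hc
      omega
    obtain ⟨l, hl⟩ : ∃ l, l ∉ insert j S := by
      by_contra! h
      have := Finset.eq_univ_iff_forall.2 h
      have := congrArg Finset.card this
      rw [Finset.card_insert_of_notMem hj, Finset.card_univ, Fintype.card_fin] at this
      omega
    rw [Finset.mem_insert, not_or] at hl
    have hcard := Finset.card_insert_of_notMem hj
    let e : Fin n → ℝ := Pi.single j 1
    let v := A.1 *ᵥ e
    by_cases hv : v - e = 0
    · refine ih (insert j S) A (by omega) fun i hi => ?_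
      rcases Finset.mem_insert.1 hi with rfl | hi
      · exact sub_eq_zero.1 hv
      · exact hA i hi
    -- The reflection in `v - e` carries `v` to `e`. The one in `u`, which is orthogonal to `e` and
    -- to the vectors already fixed, only restores determinant one.
    let u : Fin n → ℝ := Pi.single l 1
    have hu : u ≠ 0 := by simp [u]
    let R := twoReflections u (v - e) hu hv
    have hvi : ∀ i ∈ S, (v - e) i = 0 := fun i hi => by
      simp only [v, Pi.sub_apply, hA.mulVec_apply hi, sub_self]
    have hR : FixesBasis S R := fixesBasis_twoReflections hu hv (fun i hi => by
      simp only [u]; rw [Pi.single_apply, if_neg]; rintro rfl; exact hl.2 hi) hvi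
    have h1 : FixesBasis (insert j S) (R * A) := by
      intro i hi
      rcases Finset.mem_insert.1 hi with rfl | hi
      · rw [SO.coe_mul_mulVec, twoReflections_mulVec]
        change householder u *ᵥ (householder (v - e) *ᵥ v) = e
        rw [householder_sub_mulVec hv (SO.mulVec_dotProduct A e e), householder_apply_of_orthogonal]
        simp [u, e, hl.1]
      · exact (hR.mul hA) i hi
    have h2 : Joined 1 (R * A) := ih _ _ (by omega) h1
    have h3 : Joined 1 R := joined_one_twoReflections hn hu hv
    obtain ⟨p⟩ := h2
    obtain ⟨q⟩ := h3
    exact ⟨{ toFun := fun t => (q t)⁻¹ * p t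
             continuous_toFun := by fun_prop
             source' := by simp
             target' := by simp }⟩

theorem SO.pathConnectedSpace (hn : 2 ≤ n) : PathConnectedSpace (SO n) where
  nonempty := ⟨1⟩
  joined A B :=
    (joined_one_of_fixesBasis hn n ∅ A (by simp) (by simp [FixesBasis])).symm.trans
      (joined_one_of_fixesBasis hn n ∅ B (by simp) (by simp [FixesBasis]))

end SpecialOrthogonal

/-! ### Loops in `SO n` have order at most two for `n ≥ 3`. -/

section LoopsInSpecialOrthogonal

open Matrix

section TopologicalGroup

variable {G : Type*} [TopologicalSpace G] [Group G] [IsTopologicalGroup G]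

/-- The pointwise product of two loops. -/
def mulLoop (A B : Path (1 : G) 1) : Path (1 : G) 1 where
  toFun t := A t * B t
  continuous_toFun := by fun_prop
  source' := by simp
  target' := by simp

@[simp] lemma mulLoop_apply (A B : Path (1 : G) 1) (t : I) : mulLoop A B t = A t * B t := rfl

lemma mulLoop_congr {A A' B B' : Path (1 : G) 1} (hA : A.Homotopic A') (hB : B.Homotopic B') :
    (mulLoop A B).Homotopic (mulLoop A' B') := by
  obtain ⟨F, h0, h1, hl, hr⟩ := exists_square hA
  obtain ⟨F', h0', h1', hl', hr'⟩ := exists_square hB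
  exact homotopic_of_square (F * F') (fun t => by simp [h0, h0']) (fun t => by simp [h1, h1'])
    (fun s => by simp [hl, hl']) (fun s => by simp [hr, hr'])

lemma trans_homotopic_mulLoop (A B : Path (1 : G) 1) : (A.trans B).Homotopic (mulLoop A B) := by
  have h : A.trans B = mulLoop (A.trans (Path.refl 1)) ((Path.refl 1).trans B) := by
    ext t
    simp only [mulLoop_apply, Path.trans_apply]
    split_ifs <;> simp
  rw [h]
  exact mulLoop_congr ⟨Path.Homotopy.transRefl A⟩ ⟨Path.Homotopy.reflTrans B⟩

/-- Only `L (s, 0) = L (s, 1)` is required of the deformation; the factor `(L (s, 0))⁻¹` keeps the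
base point fixed. -/
lemma homotopic_of_eq_mul {γ γ' : Path (1 : G) 1} (L : C(I × I, G)) (h0 : ∀ t, L (0, t) = 1)
    (hL : ∀ s, L (s, 0) = L (s, 1)) (h : ∀ t, γ' t = (L (1, 0))⁻¹ * L (1, t) * γ t) :
    γ.Homotopic γ' :=
  homotopic_of_square ⟨fun z => (L (z.1, 0))⁻¹ * L z * γ z.2, by fun_prop⟩
    (fun t => by simp [h0]) (fun t => by simp [h]) (fun s => by simp)
    (fun s => by simp [hL])

end TopologicalGroup

variable {n : ℕ}

/-- The image of the `j`-th basis vector is a loop in a sphere. Once it misses a point `c`, it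
contracts to the base point, and a family of products of two reflections lifts the contraction to
`SO n`. -/
lemma exists_homotopic_fixesBasis_insert {S : Finset (Fin n)} {j : Fin n}
    (γ : Path (1 : SO n) 1) (hγ : ∀ t, FixesBasis S (γ t)) {c : Fin n → ℝ} (hc1 : c ⬝ᵥ c = 1)
    (hcS : ∀ i ∈ S, c i = 0) (hj : j ∉ S) (hc : ∀ t, (γ t).1 *ᵥ Pi.single j 1 ≠ c) :
    ∃ γ' : Path (1 : SO n) 1, γ.Homotopic γ' ∧ ∀ t, FixesBasis (insert j S) (γ' t) := by
  let e : Fin n → ℝ := Pi.single j 1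
  let v : I → Fin n → ℝ := fun t => (γ t).1 *ᵥ e
  have hv : Continuous v :=
    (continuous_subtype_val.comp γ.continuous).matrix_mulVec continuous_const
  have hvv : ∀ t, v t ⬝ᵥ v t = 1 := fun t => by
    rw [SO.mulVec_dotProduct]; simp [e]
  have hv0 : v 0 = e := by simp [v]
  have hv1 : v 1 = e := by simp [v]
  have hlt : ∀ t, c ⬝ᵥ (v t - c) < 0 := fun t => by
    have h1 := dotProduct_self_ne_zero (sub_ne_zero.2 (hc t))
    have h2 : 0 ≤ (v t - c) ⬝ᵥ (v t - c) := by
      simpa using dotProduct_star_self_nonneg (v t - c)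
    have h3 : 0 < (v t - c) ⬝ᵥ (v t - c) := lt_of_le_of_ne h2 (Ne.symm h1)
    simp only [sub_dotProduct, dotProduct_sub, dotProduct_comm (v t) c, hvv, hc1] at h3 ⊢
    linarith
  -- By `hlt` both ends of this segment have negative product with `c`, so it avoids `0`. At its far
  -- end the reflection in `v t - c` sends `v t` to `c`, and then the one in `e - c` sends `c` to
  -- `e`.
  let w : I × I → Fin n → ℝ := fun z => (z.1 : ℝ) • (v z.2 - c) + (1 - (z.1 : ℝ)) • (e - c)
  have hw0 : ∀ z, w z ≠ 0 := by
    rintro ⟨s, t⟩ h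
    have h1 : c ⬝ᵥ w (s, t) = 0 := by rw [h, dotProduct_zero]
    simp only [w, dotProduct_add, dotProduct_smul, smul_eq_mul] at h1
    have h2 := hlt t
    have h3 := hlt 0
    rw [hv0] at h3
    have hs0 := s.2.1
    have hs1 := s.2.2
    have h4 : (s : ℝ) = 0 := by
      by_contra hs
      have : 0 < (s : ℝ) := lt_of_le_of_ne hs0 (Ne.symm hs)
      nlinarith
    rw [h4] at h1
    linarith
  have hec : e - c ≠ 0 := sub_ne_zero.2 fun h => hc 0 (hv0.trans h)
  have hwc : Continuous w := by fun_prop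
  let L : C(I × I, SO n) := ⟨fun z => twoReflections (e - c) (w z) hec (hw0 z),
    continuous_twoReflections continuous_const hwc _ _⟩
  have hwe : ∀ z, w z = e - c → L z = 1 := fun z hz => by
    simp only [L, ContinuousMap.coe_mk, hz, twoReflections_self]
  have hL0 : ∀ s, L (s, 0) = 1 := fun s => hwe _ (by
    simp only [w, hv0]; rw [← add_smul]; simp)
  have hL1 : ∀ s, L (s, 1) = 1 := fun s => hwe _ (by
    simp only [w, hv1]; rw [← add_smul]; simp)
  refine ⟨⟨⟨fun t => (L (1, 0))⁻¹ * L (1, t) * γ t, by fun_prop⟩, by simp, by simp [hL0, hL1]⟩,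
    homotopic_of_eq_mul L (fun t => hwe _ (by simp [w])) (fun s => by rw [hL0, hL1]) fun t => rfl,
    fun t => ?_⟩
  change FixesBasis _ ((L (1, 0))⁻¹ * L (1, t) * γ t)
  rw [hL0, inv_one, one_mul]
  have hvi : ∀ i ∈ S, v t i = 0 := fun i hi => by
    simp only [v, (hγ t).mulVec_apply hi, e, Pi.single_apply]
    rw [if_neg]; rintro rfl; exact hj hi
  have hei : ∀ i ∈ S, e i = 0 := fun i hi => by
    simp only [e, Pi.single_apply]
    rw [if_neg]; rintro rfl; exact hj hi
  have hw1 : w (1, t) = v t - c := by simp [w]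
  intro i hi
  rcases Finset.mem_insert.1 hi with rfl | hi
  · rw [SO.coe_mul_mulVec]
    change (twoReflections (e - c) (w (1, t)) hec (hw0 _)).1 *ᵥ v t = e
    rw [twoReflections_mulVec, hw1, householder_sub_mulVec (sub_ne_zero.2 (hc t)) (by
      rw [hvv, hc1])]
    have h1 : householder (e - c) *ᵥ e = c := householder_sub_mulVec hec (by simp [e, hc1])
    have h2 := congrArg (householder (e - c) *ᵥ ·) h1
    simp only [mulVec_mulVec, householder_mul_self hec, one_mulVec] at h2
    exact h2.symm
  · exact ((fixesBasis_twoReflections hec (hw0 _) (fun i hi => by simp [hei i hi, hcS i hi])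
      (fun i hi => by rw [hw1]; simp [hvi i hi, hcS i hi])).mul (hγ t)) i hi

lemma exists_contDiff_near (v : C(I, ℝ)) (hv : v 0 = v 1) {ε : ℝ} (hε : 0 < ε) :
    ∃ p : ℝ → ℝ, ContDiff ℝ 1 p ∧ p 0 = p 1 ∧ ∀ t : I, |p t - v t| < ε := by
  obtain ⟨q, hq⟩ := exists_polynomial_near_of_continuousOn 0 1 (Set.IccExtend zero_le_one v)
    (v.continuous.Icc_extend' (h := zero_le_one)).continuousOn (ε / 3) (by positivity)
  have hq' : ∀ t : I, |q.eval (t : ℝ) - v t| < ε / 3 := fun t => by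
    have := hq t t.2
    rwa [Set.IccExtend_val] at this
  -- The linear term closes up the approximating polynomial. As `v 0 = v 1`, it costs less than
  -- `2ε/3` on top of the `ε/3` of the approximation.
  refine ⟨fun t => q.eval t - t * (q.eval 1 - q.eval 0), ?_, by ring, fun t => ?_⟩
  · have : ContDiff ℝ 1 fun t : ℝ => q.eval t := by
      simpa using q.contDiff_aeval (𝕜 := ℝ) 1
    fun_prop
  · have h0 := hq' 0
    have h1 := hq' 1
    have ht := hq' t
    simp only [Set.Icc.coe_zero, Set.Icc.coe_one] at h0 h1
    rw [← hv] at h1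
    have t0 := t.2.1
    have t1 := t.2.2
    rw [abs_lt] at *
    constructor <;> nlinarith

/-- General position: approximate the loop traced by the `j`-th basis vector by a `C¹` loop. The
cone over it is a `C¹` image of `ℝ²`, so it cannot fill the at least three-dimensional space of free
coordinates. Reflections lift the small deformation of the loop to `SO n`. -/
lemma exists_homotopic_avoiding {S : Finset (Fin n)} {j : Fin n} (hS : S.card + 3 ≤ n)
    (γ : Path (1 : SO n) 1) (hγ : ∀ t, FixesBasis S (γ t)) (hj : j ∉ S) :
    ∃ γ' : Path (1 : SO n) 1, γ.Homotopic γ' ∧ (∀ t, FixesBasis S (γ' t)) ∧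
      ∃ c : Fin n → ℝ, c ⬝ᵥ c = 1 ∧ (∀ i ∈ S, c i = 0) ∧
        ∀ t, (γ' t).1 *ᵥ Pi.single j 1 ≠ c := by
  let e : Fin n → ℝ := Pi.single j 1
  let v : I → Fin n → ℝ := fun t => (γ t).1 *ᵥ e
  have hv : Continuous v :=
    (continuous_subtype_val.comp γ.continuous).matrix_mulVec continuous_const
  have hvv : ∀ t, v t ⬝ᵥ v t = 1 := fun t => by
    rw [SO.mulVec_dotProduct]; simp [e]
  have hv0 : v 0 = e := by simp [v]
  have hv1 : v 1 = e := by simp [v]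
  have hvS : ∀ t, ∀ i ∈ S, v t i = 0 := fun t i hi => by
    simp only [v, (hγ t).mulVec_apply hi, e, Pi.single_apply]
    rw [if_neg]; rintro rfl; exact hj hi
  have hvle : ∀ t i, |v t i| ≤ 1 := fun t i => by
    have h1 : v t i * v t i ≤ v t ⬝ᵥ v t :=
      Finset.single_le_sum (f := fun i => v t i * v t i) (fun i _ => mul_self_nonneg _)
        (Finset.mem_univ i)
    rw [hvv] at h1
    rw [abs_le]; constructor <;> nlinarith
  -- With `n` coordinate errors of this size the total is below `1`, which keeps the product of the
  -- loop with its approximation positive.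
  have hε : (0 : ℝ) < 1 / (n + 1) := by positivity
  choose p hpc hp01 hpv using fun i : Fin n =>
    exists_contDiff_near ⟨fun t => v t i, by fun_prop⟩ (by simp [hv0, hv1]) hε
  let T := {i : Fin n // i ∉ S}
  let ext : (T → ℝ) → Fin n → ℝ := fun x i => if h : i ∉ S then x ⟨i, h⟩ else 0
  let P : ℝ → T → ℝ := fun t i => p i.1 t
  have hPc : ContDiff ℝ 1 P := contDiff_pi.2 fun i => hpc i.1
  have hTcard : Fintype.card T = n - S.card := by
    rw [Fintype.card_subtype_compl]; simp
  obtain ⟨c₀, hc₀⟩ : ∃ c₀ : T → ℝ, ∀ (r t : ℝ), r • P t ≠ c₀ := by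
    have hd := ContDiff.dense_compl_range_of_finrank_lt_finrank
      (f := fun z : ℝ × ℝ => z.1 • P z.2) (by fun_prop) (by
        rw [Module.finrank_prod, Module.finrank_self, Module.finrank_fintype_fun_eq_card, hTcard]
        omega)
    obtain ⟨c₀, hc₀⟩ := hd.nonempty
    exact ⟨c₀, fun r t h => hc₀ ⟨(r, t), h⟩⟩
  have hextS : ∀ x, ∀ i ∈ S, ext x i = 0 := fun x i hi => by simp [ext, hi]
  have hext : ∀ x y, ext x = ext y → x = y := fun x y h => by
    funext i
    have := congrFun h i.1
    simpa [ext, i.2] using this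
  have hextsmul : ∀ (r : ℝ) x, ext (r • x) = r • ext x := fun r x => by
    funext i
    by_cases hi : i ∈ S <;> simp [ext, hi]
  have hvP : ∀ t : I, 0 < v t ⬝ᵥ ext (P t) := by
    intro t
    have h1 : v t ⬝ᵥ ext (P t) = 1 + ∑ i, v t i * (ext (P t) i - v t i) := by
      rw [← hvv t, dotProduct, dotProduct, ← Finset.sum_add_distrib]
      exact Finset.sum_congr rfl fun i _ => by ring
    have h2 : |∑ i, v t i * (ext (P t) i - v t i)| ≤ ∑ _i : Fin n, 1 / ((n : ℝ) + 1) := by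
      refine (Finset.abs_sum_le_sum_abs _ _).trans (Finset.sum_le_sum fun i _ => ?_)
      rw [abs_mul]
      have h3 : |ext (P t) i - v t i| ≤ 1 / ((n : ℝ) + 1) := by
        by_cases hi : i ∈ S
        · rw [hextS _ i hi, hvS t i hi]; simpa using hε.le
        · simpa [ext, hi, P] using (hpv i t).le
      calc |v t i| * |ext (P t) i - v t i| ≤ 1 * (1 / ((n : ℝ) + 1)) :=
            mul_le_mul (hvle t i) h3 (abs_nonneg _) zero_le_one
        _ = _ := one_mul _
    rw [Finset.sum_const, Finset.card_univ, Fintype.card_fin, nsmul_eq_mul] at h2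
    have h4 : (n : ℝ) * (1 / ((n : ℝ) + 1)) < 1 := by
      rw [mul_one_div, div_lt_one (by positivity)]; linarith
    rw [h1]
    have := (abs_le.1 h2).1
    linarith
  have hPne : ∀ t : I, ext (P t) ≠ 0 := fun t h => by
    have := hvP t
    rw [h, dotProduct_zero] at this
    exact lt_irrefl _ this
  have hpos : ∀ x : Fin n → ℝ, x ≠ 0 → 0 < √(x ⬝ᵥ x) := fun x hx =>
    Real.sqrt_pos.2 (lt_of_le_of_ne (by simpa using dotProduct_star_self_nonneg x)
      (Ne.symm (dotProduct_self_ne_zero hx)))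
  have hnorm : ∀ x : Fin n → ℝ, x ≠ 0 → ((√(x ⬝ᵥ x))⁻¹ • x) ⬝ᵥ ((√(x ⬝ᵥ x))⁻¹ • x) = 1 := by
    intro x hx
    have h1 := hpos x hx
    have h2 : √(x ⬝ᵥ x) * √(x ⬝ᵥ x) = x ⬝ᵥ x :=
      Real.mul_self_sqrt (by simpa using dotProduct_star_self_nonneg x)
    have h3 : ∀ r q : ℝ, 0 < r → r * r = q → r⁻¹ * (r⁻¹ * q) = 1 := by
      rintro r _ hr rfl
      field_simp
    rw [smul_dotProduct, dotProduct_smul, smul_eq_mul, smul_eq_mul, h3 _ _ h1 h2]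
  let u : I → Fin n → ℝ := fun t => (√(ext (P t) ⬝ᵥ ext (P t)))⁻¹ • ext (P t)
  have hextc : Continuous fun t : I => ext (P t) := by
    refine continuous_pi fun i => ?_
    by_cases hi : i ∈ S
    · simpa [ext, hi] using continuous_const
    · simpa [ext, hi, P, Function.comp_def] using (hpc i).continuous.comp continuous_subtype_val
  have huc : Continuous u :=
    ((hextc.dotProduct hextc).sqrt.inv₀ fun t => (hpos _ (hPne t)).ne').smul hextc
  have huu : ∀ t, u t ⬝ᵥ u t = 1 := fun t => hnorm _ (hPne t)
  have hu01 : u 0 = u 1 := by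
    have : P ((0 : I) : ℝ) = P ((1 : I) : ℝ) := by
      funext i; exact hp01 i.1
    simp only [u, this]
  have huS : ∀ t, ∀ i ∈ S, u t i = 0 := fun t i hi => by
    simp [u, hextS _ i hi]
  have hvu : ∀ t, 0 < v t ⬝ᵥ u t := fun t => by
    simp only [u, dotProduct_smul, smul_eq_mul]
    exact mul_pos (inv_pos.2 (hpos _ (hPne t))) (hvP t)
  have hvne : ∀ t, v t ≠ 0 := fun t h => by
    have := hvv t
    rw [h] at this; simp at this
  -- The reflection in `v` followed by the one in `v + s u` is `1` at `s = 0`; at `s = 1` it sends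
  -- `v` to `-v` and then to `u`. Positivity of `v ⬝ᵥ u` keeps `w` away from zero.
  let w : I × I → Fin n → ℝ := fun z => v z.2 + (z.1 : ℝ) • u z.2
  have hw0 : ∀ z, w z ≠ 0 := by
    rintro ⟨s, t⟩ h
    have h1 : v t ⬝ᵥ w (s, t) = 0 := by rw [h, dotProduct_zero]
    simp only [w, dotProduct_add, dotProduct_smul, smul_eq_mul, hvv] at h1
    have := mul_nonneg s.2.1 (hvu t).le
    linarith
  let L : C(I × I, SO n) := ⟨fun z => twoReflections (w z) (v z.2) (hw0 z) (hvne _),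
    continuous_twoReflections (by fun_prop) (by fun_prop) _ _⟩
  have hL01 : ∀ s, L (s, 0) = L (s, 1) := fun s => by
    have h1 : w (s, 0) = w (s, 1) := by simp only [w, hv0, hv1, hu01]
    have h2 : v 0 = v 1 := hv0.trans hv1.symm
    simp only [L, ContinuousMap.coe_mk, h1, h2]
  have hLS : ∀ z, FixesBasis S (L z) := fun z => fixesBasis_twoReflections (hw0 z) (hvne _)
    (fun i hi => by simp [w, hvS _ i hi, huS _ i hi]) (hvS _)
  have hLv : ∀ t, (L (1, t)).1 *ᵥ v t = u t := fun t => by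
    have h1 : w (1, t) = v t + u t := by simp [w]
    change (twoReflections (w (1, t)) (v t) (hw0 _) (hvne t)).1 *ᵥ v t = u t
    rw [twoReflections_mulVec, householder_self_mulVec (hvne t), mulVec_neg, h1,
      householder_add_mulVec (h1 ▸ hw0 _) (by rw [hvv, huu]), neg_neg]
  have hc0ne : ext c₀ ≠ 0 := fun h => by
    have h0 : ext (0 : T → ℝ) = 0 := by
      have := hextsmul 0 0
      rw [zero_smul, zero_smul] at this
      exact this
    exact hc₀ 0 0 (by rw [zero_smul]; exact (hext _ _ (h.trans h0.symm)).symm)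
  let c := (√(ext c₀ ⬝ᵥ ext c₀))⁻¹ • ext c₀
  -- The new loop is normalized by `(L (1, 0))⁻¹`, so the missed point `c` has to be moved by the
  -- same matrix.
  refine ⟨⟨⟨fun t => (L (1, 0))⁻¹ * L (1, t) * γ t, by fun_prop⟩, by simp, by simp [hL01]⟩,
    homotopic_of_eq_mul L (fun t => ?_) hL01 fun t => rfl,
    fun t => ((hLS _).inv.mul (hLS _)).mul (hγ t), (L (1, 0))⁻¹.1 *ᵥ c, ?_, ?_, ?_⟩
  · have : w (0, t) = v t := by simp [w]
    simp only [L, ContinuousMap.coe_mk, this, twoReflections_self]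
  · rw [SO.mulVec_dotProduct]; exact hnorm _ hc0ne
  · intro i hi
    rw [(hLS _).inv.mulVec_apply hi]
    simp [c, hextS _ i hi]
  · intro t h
    change ((L (1, 0))⁻¹ * L (1, t) * γ t).1 *ᵥ e = _ at h
    rw [SO.coe_mul_mulVec, SO.coe_mul_mulVec, SO.inv_mulVec_eq_iff, ← SO.coe_mul_mulVec (L (1, 0)),
      mul_inv_cancel, SO.coe_one, one_mulVec] at h
    have h' : u t = c := (hLv t).symm.trans h
    have h2 : ext ((√(ext c₀ ⬝ᵥ ext c₀) * (√(ext (P t) ⬝ᵥ ext (P t)))⁻¹) • P t) = ext c₀ := by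
      rw [hextsmul, mul_smul]
      change _ • u t = _
      rw [h']
      simp only [c]
      rw [smul_smul, mul_inv_cancel₀ (hpos _ hc0ne).ne', one_smul]
    exact hc₀ _ _ (hext _ _ h2)

/-- Each new fixed vector needs three free directions before it is added, so the procedure can reach
a single free plane: every loop is homotopic to a loop of rotations of a coordinate plane. -/
lemma exists_homotopic_fixesBasis (m : ℕ) (hm : m + 2 ≤ n) (γ : Path (1 : SO n) 1) :
    ∃ γ' : Path (1 : SO n) 1, γ.Homotopic γ' ∧ ∃ S : Finset (Fin n), S.card = m ∧
      ∀ t, FixesBasis S (γ' t) := by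
  induction m with
  | zero => exact ⟨γ, .refl γ, ∅, rfl, fun t => by simp [FixesBasis]⟩
  | succ m ih =>
    obtain ⟨γ₁, h1, S, hS, hf⟩ := ih (by omega)
    obtain ⟨j, hj⟩ : ∃ j, j ∉ S := by
      by_contra! h
      have := Finset.eq_univ_iff_forall.2 h
      rw [this, Finset.card_univ, Fintype.card_fin] at hS
      omega
    obtain ⟨γ₂, h2, hf2, c, hc1, hcS, hc⟩ := exists_homotopic_avoiding (by omega) γ₁ hf hj
    obtain ⟨γ₃, h3, hf3⟩ := exists_homotopic_fixesBasis_insert γ₂ hf2 hc1 hcS hj hc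
    exact ⟨γ₃, (h1.trans h2).trans h3, insert j S, by rw [Finset.card_insert_of_notMem hj, hS], hf3⟩

/-- When both directions are free, the block of `A` in the plane of `a` and `b` is a rotation. -/
lemma apply_eq_neg_of_fixesBasis {S : Finset (Fin n)} {a b : Fin n} (hab : a ≠ b)
    (hS : ∀ i, i ∉ S → i = a ∨ i = b) {A : SO n} (hA : FixesBasis S A) :
    A.1 a b = - A.1 b a := by
  by_cases haS : a ∈ S
  · have h1 := hA.mulVec_apply haS (Pi.single b 1)
    have h2 := congrFun (hA a haS) b
    simp only [mulVec_single_one, col_apply] at h1 h2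
    rw [h1, h2]; simp [hab, hab.symm]
  by_cases hbS : b ∈ S
  · have h1 := hA.mulVec_apply hbS (Pi.single a 1)
    have h2 := congrFun (hA b hbS) a
    simp only [mulVec_single_one, col_apply] at h1 h2
    rw [h1, h2]; simp [hab, hab.symm]
  let C : Matrix (Fin n) (Fin 2) ℝ := Matrix.of fun i k =>
    if k = 0 then A.1 i a - (1 : Matrix (Fin n) (Fin n) ℝ) i a
    else A.1 i b - (1 : Matrix (Fin n) (Fin n) ℝ) i b
  let E : Matrix (Fin 2) (Fin n) ℝ := Matrix.of fun k i =>
    if k = 0 then (1 : Matrix (Fin n) (Fin n) ℝ) a i else (1 : Matrix (Fin n) (Fin n) ℝ) b i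
  -- `A - 1` is supported in the columns `a` and `b`. Exchanging the factors in the determinant of
  -- `1 + C * E` reduces it to that of the 2 × 2 block.
  have hAC : A.1 = 1 + C * E := by
    ext i k
    simp only [Matrix.add_apply, Matrix.mul_apply, Fin.sum_univ_two, C, E, of_apply, if_true,
      one_ne_zero, if_false]
    by_cases hka : k = a
    · subst hka; simp [Matrix.one_apply_ne hab.symm]
    by_cases hkb : k = b
    · subst hkb; simp [Matrix.one_apply_ne hab]
    have hk : k ∈ S := by
      by_contra h
      rcases hS k h with h | h
      exacts [hka h, hkb h]
    have h2 := congrFun (hA k hk) i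
    simp only [mulVec_single_one, col_apply] at h2
    rw [Matrix.one_apply_ne (Ne.symm hka), Matrix.one_apply_ne (Ne.symm hkb), h2]
    simp [Matrix.one_apply, Pi.single_apply]
  have hdet := SO.det_eq A
  rw [hAC, det_one_add_mul_comm, det_fin_two] at hdet
  have hEC : ∀ k : Fin 2, ∀ l : Fin 2, ((1 : Matrix (Fin 2) (Fin 2) ℝ) + E * C) k l =
      A.1 (if k = 0 then a else b) (if l = 0 then a else b) := by
    intro k l
    fin_cases k <;> fin_cases l <;>
      simp [Matrix.mul_apply, C, E, Matrix.one_apply, hab, hab.symm, Finset.sum_ite_eq]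
  simp only [hEC, if_true, one_ne_zero, if_false] at hdet
  have hsum : ∀ x y : Fin n, (x = a ∨ x = b) → A.1 a x * A.1 a y + A.1 b x * A.1 b y =
      (1 : Matrix (Fin n) (Fin n) ℝ) x y := by
    intro x y hx
    have h1 := congrFun (congrFun (SO.transpose_mul A) x) y
    rw [Matrix.mul_apply] at h1
    rw [← h1, ← Finset.sum_subset (Finset.subset_univ {a, b}), Finset.sum_pair hab]
    · rfl
    · intro i _ hi
      simp only [Finset.mem_insert, Finset.mem_singleton, not_or] at hi
      have hiS : i ∈ S := by
        by_contra h
        rcases hS i h with h | h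
        exacts [hi.1 h, hi.2 h]
      have h2 := hA.mulVec_apply hiS (Pi.single x 1)
      simp only [mulVec_single_one, col_apply] at h2
      rw [transpose_apply, h2, Pi.single_apply, if_neg, zero_mul]
      rintro rfl
      rcases hx with hx | hx
      exacts [hi.1 hx, hi.2 hx]
  have haa := hsum a a (Or.inl rfl)
  have hbb := hsum b b (Or.inr rfl)
  rw [Matrix.one_apply_eq] at haa hbb
  -- Unit columns and determinant one make the sum of these two squares vanish.
  nlinarith [sq_nonneg (A.1 a a - A.1 b b), sq_nonneg (A.1 a b + A.1 b a)]

/-- Conjugation by a reflection of the plane inverts its rotations. A fixed direction `c`, which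
exists since `n ≥ 3`, is negated too so that the conjugating matrix lies in `SO n`; thus `γ` is
homotopic to its pointwise inverse. -/
lemma homotopic_inv_of_fixesBasis (hn : 3 ≤ n) {S : Finset (Fin n)} (hS : S.card + 2 = n)
    (γ : Path (1 : SO n) 1) (hγ : ∀ t, FixesBasis S (γ t)) :
    (mulLoop γ γ).Homotopic (Path.refl 1) := by
  have : PathConnectedSpace (SO n) := SO.pathConnectedSpace (by omega)
  obtain ⟨a, b, hab, hSc⟩ : ∃ a b, a ≠ b ∧ Sᶜ = {a, b} := Finset.card_eq_two.1 (by
    rw [Finset.card_compl, Fintype.card_fin]; omega)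
  have hS' : ∀ i, i ∉ S → i = a ∨ i = b := fun i hi => by
    have : i ∈ Sᶜ := by simpa
    rw [hSc] at this
    simpa using this
  have haS : a ∉ S := by
    have : a ∈ Sᶜ := by rw [hSc]; simp
    simpa using this
  have hbS : b ∉ S := by
    have : b ∈ Sᶜ := by rw [hSc]; simp
    simpa using this
  obtain ⟨c, hc⟩ : S.Nonempty := Finset.card_pos.1 (by omega)
  have hbc : b ≠ c := by rintro rfl; exact hbS hc
  have hac : a ≠ c := by rintro rfl; exact haS hc
  let d : Fin n → ℝ := fun i => if i = b ∨ i = c then -1 else 1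
  have hdd : ∀ i, d i * d i = 1 := fun i => by simp only [d]; split_ifs <;> norm_num
  let D : SO n := ⟨diagonal d, SO.mem_of
    (by rw [diagonal_transpose, diagonal_mul_diagonal]; simp [hdd]) (by
      rw [det_diagonal]
      have h1 : ∀ i, d i = (if i = b then -1 else 1) * (if i = c then -1 else 1) := fun i => by
        simp only [d]
        by_cases h : i = b
        · subst h; simp [hbc]
        · simp [h]
      simp only [h1, Finset.prod_mul_distrib]
      simp)⟩
  have hD : D⁻¹ = D := Subtype.ext (diagonal_transpose d)
  have hconj : ∀ t, D⁻¹ * γ t * D = (γ t)⁻¹ := by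
    intro t
    rw [hD]
    refine Subtype.ext (Matrix.ext fun x y => ?_)
    change (diagonal d * (γ t).1 * diagonal d) x y = (γ t).1 y x
    rw [mul_diagonal, diagonal_mul]
    by_cases hxy : x = y
    · subst hxy; rw [mul_right_comm, hdd, one_mul]
    have hrow : ∀ i ∈ S, ∀ k, i ≠ k → (γ t).1 i k = 0 := fun i hi k hik => by
      have := (hγ t).mulVec_apply hi (Pi.single k 1)
      simp only [mulVec_single_one, col_apply] at this
      rw [this, Pi.single_apply, if_neg hik]
    have hcol : ∀ i ∈ S, ∀ k, i ≠ k → (γ t).1 k i = 0 := fun i hi k hik => by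
      have := congrFun (hγ t i hi) k
      simp only [mulVec_single_one, col_apply] at this
      rw [this, Pi.single_apply, if_neg (Ne.symm hik)]
    by_cases hx : x ∈ S
    · rw [hrow x hx y hxy, hcol x hx y hxy]; simp
    by_cases hy : y ∈ S
    · rw [hrow y hy x (Ne.symm hxy), hcol y hy x (Ne.symm hxy)]; simp
    have hneg := apply_eq_neg_of_fixesBasis hab hS' (hγ t)
    have hda : d a = 1 := by simp [d, hab, hac]
    have hdb : d b = -1 := by simp [d]
    rcases hS' x hx with rfl | rfl <;> rcases hS' y hy with rfl | rfl
    · exact absurd rfl hxy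
    · rw [hda, hdb, hneg]; ring
    · rw [hda, hdb, hneg]; ring
    · exact absurd rfl hxy
  have h1 : mulLoop γ (conjPath D γ) = Path.refl 1 := by
    refine Path.ext (funext fun t => ?_)
    simp [hconj]
  rw [← h1]
  exact mulLoop_congr (.refl γ) (conjPath_homotopic D γ).symm

/-- The fundamental group of `SO n` has exponent two for `n ≥ 3`. -/
theorem SO.trans_self_homotopic_refl (hn : 3 ≤ n) (γ : Path (1 : SO n) 1) :
    (γ.trans γ).Homotopic (Path.refl 1) := by
  obtain ⟨γ', h, S, hS, hf⟩ := exists_homotopic_fixesBasis (n - 2) (by omega) γ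
  exact (h.hcomp h).trans ((trans_homotopic_mulLoop γ' γ').trans
    (homotopic_inv_of_fixesBasis hn (by omega) γ' hf))

lemma homotopic_refl_or_of_generator {G : Type*} [TopologicalSpace G] [Group G]
    [IsTopologicalGroup G] {η : Path (1 : G) 1} (hη : ∀ g : FundamentalGroup G 1,
      g ∈ Subgroup.zpowers (FundamentalGroup.fromPath (Path.Homotopic.Quotient.mk η)))
    (hη2 : (η.trans η).Homotopic (Path.refl 1)) (B : Path (1 : G) 1) :
    B.Homotopic (Path.refl 1) ∨ B.Homotopic η := by
  obtain ⟨m, hm⟩ := hη (FundamentalGroup.fromPath (Path.Homotopic.Quotient.mk B))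
  dsimp only at hm
  generalize hg : (FundamentalGroup.fromPath (Path.Homotopic.Quotient.mk η)) = g at hm
  have h2 : g * g = 1 := by
    rw [← hg, FundamentalGroup.mul_def, FundamentalGroup.one_def]
    exact Quotient.sound hη2
  rcases Int.even_or_odd' m with ⟨k, rfl | rfl⟩
  · left
    rw [_root_.zpow_mul, zpow_two, h2, _root_.one_zpow] at hm
    exact Quotient.exact hm.symm
  · right
    rw [_root_.zpow_add, _root_.zpow_mul, zpow_two, h2, _root_.one_zpow, one_mul, zpow_one, ← hg] at hm
    exact Quotient.exact hm.symm

end LoopsInSpecialOrthogonal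

/-! ### The oriented orthonormal frames as a principal bundle. -/

section FrameBundle

open Matrix

/-- The standard basis vectors of `ℝⁿ`. -/
noncomputable abbrev stdVec {n : ℕ} (i : Fin n) : Euc n := EuclideanSpace.single i (1 : ℝ)

lemma sum_smul_stdVec {n : ℕ} (x : Euc n) : ∑ i, x i • stdVec i = x := by
  have := (EuclideanSpace.basisFun (Fin n) ℝ).sum_repr x
  simpa using this

/-- The isometry of `ℝⁿ` given by a special orthogonal matrix. -/
noncomputable def SO.isometry {n : ℕ} (A : SO n) : Euc n ≃ₗᵢ[ℝ] Euc n where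
  toLinearEquiv := LinearEquiv.ofLinearMap (toEuclideanLin A.1) (toEuclideanLin (A⁻¹).1)
    (by
      ext1 x
      change WithLp.toLp 2 (A.1 *ᵥ ((A⁻¹).1 *ᵥ x.ofLp)) = x
      rw [← SO.coe_mul_mulVec, mul_inv_cancel, SO.coe_one, one_mulVec])
    (by
      ext1 x
      change WithLp.toLp 2 ((A⁻¹).1 *ᵥ (A.1 *ᵥ x.ofLp)) = x
      rw [← SO.coe_mul_mulVec, inv_mul_cancel, SO.coe_one, one_mulVec])
  norm_map' x := by
    change ‖WithLp.toLp 2 (A.1 *ᵥ x.ofLp)‖ = ‖x‖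
    rw [← sq_eq_sq₀ (norm_nonneg _) (norm_nonneg _), ← real_inner_self_eq_norm_sq,
      ← real_inner_self_eq_norm_sq, EuclideanSpace.inner_eq_star_dotProduct,
      EuclideanSpace.inner_eq_star_dotProduct]
    exact SO.mulVec_dotProduct A _ _

lemma SO.isometry_apply {n : ℕ} (A : SO n) (x : Euc n) :
    SO.isometry A x = toEuclideanLin A.1 x := rfl

lemma SO.isometry_mul {n : ℕ} (A B : SO n) (x : Euc n) :
    SO.isometry (A * B) x = SO.isometry A (SO.isometry B x) := by
  change WithLp.toLp 2 ((A * B).1 *ᵥ x.ofLp) = WithLp.toLp 2 (A.1 *ᵥ (B.1 *ᵥ x.ofLp))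
  rw [SO.coe_mul_mulVec]

@[simp] lemma SO.isometry_one {n : ℕ} (x : Euc n) : SO.isometry (1 : SO n) x = x := by
  change WithLp.toLp 2 ((1 : Matrix _ _ ℝ) *ᵥ x.ofLp) = x
  rw [one_mulVec]

lemma SO.isometry_injective {n : ℕ} {A B : SO n} (h : ∀ x, SO.isometry A x = SO.isometry B x) :
    A = B :=
  Subtype.ext (toEuclideanLin.injective (LinearMap.ext h))

lemma SO.continuous_isometry {n : ℕ} :
    Continuous fun z : SO n × Euc n => SO.isometry z.1 z.2 := by
  refine (PiLp.continuous_toLp 2 _).comp (Continuous.matrix_mulVec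
    (continuous_subtype_val.comp continuous_fst)
    ((PiLp.continuous_ofLp 2 _).comp continuous_snd))

lemma SO.map_isometry {n : ℕ} (A : SO n) :
    Orientation.map (Fin n) (SO.isometry A).toLinearEquiv (stdOrientation n) = stdOrientation n := by
  rw [Orientation.map_eq_iff_det_pos _ _ (by simp)]
  change 0 < LinearMap.det (toEuclideanLin A.1)
  rw [LinearMap.det_toLpLin, SO.det_eq]
  exact zero_lt_one

/-- The matrix of an orientation-preserving isometry of `ℝⁿ`. -/
noncomputable def SO.ofIsometry {n : ℕ} (f : Euc n ≃ₗᵢ[ℝ] Euc n)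
    (hf : Orientation.map (Fin n) f.toLinearEquiv (stdOrientation n) = stdOrientation n) : SO n :=
  ⟨toEuclideanLin.symm f.toLinearEquiv.toLinearMap, by
    set M := toEuclideanLin.symm f.toLinearEquiv.toLinearMap with hM
    have hfM : ∀ x, toEuclideanLin M x = f x := fun x => by
      rw [hM, LinearEquiv.apply_symm_apply]; rfl
    have h1 : Mᵀ * M = 1 := by
      ext i j
      have h := f.inner_map_map (stdVec i) (stdVec j)
      rw [← hfM, ← hfM, EuclideanSpace.inner_eq_star_dotProduct,
        EuclideanSpace.inner_eq_star_dotProduct] at h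
      simpa [Matrix.mul_apply, dotProduct, Matrix.one_apply, mul_comm, eq_comm,
        Pi.single_apply] using h
    refine SO.mem_of h1 ?_
    rw [Orientation.map_eq_iff_det_pos _ _ (by simp)] at hf
    have h2 : 0 < M.det := by
      have h4 : LinearMap.det (toEuclideanLin M) = M.det := by rw [LinearMap.det_toLpLin]
      rwa [← h4, hM, LinearEquiv.apply_symm_apply]
    -- Orthogonality gives a determinant of square one, and preservation of orientation selects the
    -- positive sign.
    have h3 := congrArg Matrix.det h1
    rw [det_mul, det_transpose, det_one] at h3
    nlinarith⟩

lemma SO.isometry_ofIsometry {n : ℕ} (f : Euc n ≃ₗᵢ[ℝ] Euc n)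
    (hf : Orientation.map (Fin n) f.toLinearEquiv (stdOrientation n) = stdOrientation n)
    (x : Euc n) : SO.isometry (SO.ofIsometry f hf) x = f x := by
  change toEuclideanLin (toEuclideanLin.symm f.toLinearEquiv.toLinearMap) x = f x
  rw [LinearEquiv.apply_symm_apply]
  rfl

lemma SO.ofIsometry_apply {n : ℕ} (f : Euc n ≃ₗᵢ[ℝ] Euc n)
    (hf : Orientation.map (Fin n) f.toLinearEquiv (stdOrientation n) = stdOrientation n)
    (i j : Fin n) : (SO.ofIsometry f hf).1 i j = f (stdVec j) i := by
  rw [← SO.isometry_ofIsometry f hf, SO.isometry_apply]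
  simp

lemma Orientation.map_trans' {ι M M' M'' : Type*} [AddCommGroup M] [Module ℝ M]
    [AddCommGroup M'] [Module ℝ M'] [AddCommGroup M''] [Module ℝ M''] (f : M ≃ₗ[ℝ] M')
    (g : M' ≃ₗ[ℝ] M'') (o : Orientation ℝ M ι) :
    Orientation.map ι (f.trans g) o = Orientation.map ι g (Orientation.map ι f o) := by
  induction o using Module.Ray.ind with
  | h f hf => rfl

namespace OrientedEuclideanBundle

variable {B : Type u} [TopologicalSpace B] {n : ℕ} {E : OrientedEuclideanBundle.{u, v} B n}

lemma Frame.ext' {b : B} {p p' : E.Frame b} (h : ∀ x, p.iso x = p'.iso x) : p = p' := by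
  obtain ⟨f, hf⟩ := p
  obtain ⟨f', hf'⟩ := p'
  obtain rfl : f = f' := LinearIsometryEquiv.ext h
  rfl

/-- The action of `SO n` on frames. -/
noncomputable def Frame.act {b : B} (p : E.Frame b) (A : SO n) : E.Frame b where
  iso := (SO.isometry A).trans p.iso
  map_orient := by
    conv_rhs => rw [← p.map_orient, ← SO.map_isometry A]
    exact Orientation.map_trans' _ _ _

/-- The frame given by an orthonormal basis. -/
noncomputable def Frame.ofBasis {b : B} (g : OrthonormalBasis (Fin n) ℝ (E.Fib b))
    (hg : g.toBasis.orientation = E.orient b) : E.Frame b where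
  iso := g.repr.symm
  map_orient := by
    rw [← hg, stdOrientation, ← Module.Basis.orientation_map]
    have : (EuclideanSpace.basisFun (Fin n) ℝ).toBasis.map g.repr.symm.toLinearEquiv =
        g.toBasis := by
      refine DFunLike.ext _ _ fun i => ?_
      simp
    rw [this]

/-- An orientation-preserving isometry of the fibre, read in two frames. -/
noncomputable def Frame.matrixOf {b : B} (p p' : E.Frame b) (φ : E.Fib b ≃ₗᵢ[ℝ] E.Fib b)
    (hφ : Orientation.map (Fin n) φ.toLinearEquiv (E.orient b) = E.orient b) : SO n :=
  SO.ofIsometry ((p'.iso.trans φ).trans p.iso.symm) (by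
    have h := p.map_orient
    rw [← hφ, ← p'.map_orient] at h
    change Orientation.map (Fin n) ((p'.iso.toLinearEquiv.trans φ.toLinearEquiv).trans
      p.iso.toLinearEquiv.symm) _ = _
    rw [Orientation.map_trans', Orientation.map_trans', ← h]
    exact (Orientation.map (Fin n) p.iso.toLinearEquiv).symm_apply_apply _)

lemma Frame.apply_matrixOf {b : B} (p p' : E.Frame b) (φ : E.Fib b ≃ₗᵢ[ℝ] E.Fib b)
    (hφ : Orientation.map (Fin n) φ.toLinearEquiv (E.orient b) = E.orient b) (x : Euc n) :
    p.iso (SO.isometry (p.matrixOf p' φ hφ) x) = φ (p'.iso x) := by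
  rw [Frame.matrixOf, SO.isometry_ofIsometry]
  simp

lemma Frame.matrixOf_apply {b : B} (p p' : E.Frame b) (φ : E.Fib b ≃ₗᵢ[ℝ] E.Fib b)
    (hφ : Orientation.map (Fin n) φ.toLinearEquiv (E.orient b) = E.orient b) (i j : Fin n) :
    (p.matrixOf p' φ hφ).1 i j = inner ℝ (p.iso (stdVec i)) (φ (p'.iso (stdVec j))) := by
  rw [Frame.matrixOf, SO.ofIsometry_apply, ← p.iso.symm.inner_map_map, p.iso.symm_apply_apply]
  simp [EuclideanSpace.inner_single_left]

lemma map_refl_orient (b : B) : Orientation.map (Fin n)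
    (LinearIsometryEquiv.refl ℝ (E.Fib b)).toLinearEquiv (E.orient b) = E.orient b := by
  change Orientation.map (Fin n) (LinearEquiv.refl ℝ (E.Fib b)) (E.orient b) = E.orient b
  simp

/-- The special orthogonal matrix by which two frames differ. -/
noncomputable def Frame.diff {b : B} (p p' : E.Frame b) : SO n :=
  p.matrixOf p' (LinearIsometryEquiv.refl ℝ _) (map_refl_orient b)

lemma Frame.apply_diff {b : B} (p p' : E.Frame b) (x : Euc n) :
    p.iso (SO.isometry (p.diff p') x) = p'.iso x := p.apply_matrixOf _ _ _ x

variable (E) in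
/-- The total space of the bundle of frames of `E`. -/
def FrameSpace : Type _ := Σ b, E.Frame b

/-- The value of a frame on a vector, as a point of the total space. -/
noncomputable def FrameSpace.eval (p : E.FrameSpace) (x : Euc n) : E.Total := ⟨p.1, p.2.iso x⟩

/-- Pointwise convergence on vectors. Since a frame is determined linearly by `n` vectors, joint
continuity of evaluation still holds (`FrameSpace.continuous_eval`). -/
noncomputable instance : TopologicalSpace E.FrameSpace :=
  TopologicalSpace.induced FrameSpace.eval inferInstance

lemma continuous_frameSpace_iff {Y : Type*} [TopologicalSpace Y] {f : Y → E.FrameSpace} :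
    Continuous f ↔ ∀ x, Continuous fun y => (f y).eval x := by
  rw [continuous_induced_rng, continuous_pi_iff]
  rfl

lemma continuousOn_frameSpace_iff {Y : Type*} [TopologicalSpace Y] {f : Y → E.FrameSpace}
    {s : Set Y} : ContinuousOn f s ↔ ∀ x, ContinuousOn (fun y => (f y).eval x) s := by
  simp only [continuousOn_iff_continuous_domRestrict, continuous_frameSpace_iff]
  rfl

lemma FrameSpace.continuous_eval_right (x : Euc n) :
    Continuous fun p : E.FrameSpace => p.eval x :=
  continuous_frameSpace_iff.1 continuous_id x

lemma FrameSpace.continuous_fst : Continuous fun p : E.FrameSpace => p.1 :=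
  (FiberBundle.continuous_proj (Euc n) E.Fib).comp (FrameSpace.continuous_eval_right 0)

/-- A local trivialization is linear on fibres, so it turns a combination in a varying fibre into
one in `ℝⁿ`. -/
lemma continuousWithinAt_sum {Y ι : Type*} [TopologicalSpace Y] {s : Set Y} {y₀ : Y} {b : Y → B}
    (hb : ContinuousWithinAt b s y₀) (F : Finset ι) {a : ι → Y → ℝ}
    {x : ∀ _ : ι, ∀ y, E.Fib (b y)} (ha : ∀ i ∈ F, ContinuousWithinAt (a i) s y₀)
    (hx : ∀ i ∈ F, ContinuousWithinAt (fun y => (⟨b y, x i y⟩ : E.Total)) s y₀) :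
    ContinuousWithinAt (fun y => (⟨b y, ∑ i ∈ F, a i y • x i y⟩ : E.Total)) s y₀ := by
  rw [FiberBundle.continuousWithinAt_totalSpace]
  refine ⟨hb, ?_⟩
  let e := trivializationAt (Euc n) E.Fib (b y₀)
  have hmem : b ⁻¹' e.baseSet ∈ 𝓝[s] y₀ :=
    hb (e.open_baseSet.mem_nhds (FiberBundle.mem_baseSet_trivializationAt' _))
  have hlin : ∀ y ∈ b ⁻¹' e.baseSet, (e (⟨b y, ∑ i ∈ F, a i y • x i y⟩ : E.Total)).2 =
      ∑ i ∈ F, a i y • (e (⟨b y, x i y⟩ : E.Total)).2 := by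
    intro y hy
    change e.linearEquivAt ℝ (b y) hy _ = ∑ i ∈ F, a i y • e.linearEquivAt ℝ (b y) hy _
    simp only [map_sum, map_smul]
  have hc : ContinuousWithinAt
      (fun y => ∑ i ∈ F, a i y • (e (⟨b y, x i y⟩ : E.Total)).2) s y₀ := by
    refine tendsto_finsetSum _ fun i hi => ?_
    exact (ha i hi).smul ((FiberBundle.continuousWithinAt_totalSpace _ _).1 (hx i hi)).2
  refine hc.congr_of_eventuallyEq (Filter.mem_of_superset hmem hlin) (hlin _ ?_)
  exact FiberBundle.mem_baseSet_trivializationAt' _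

lemma continuousOn_sum {Y ι : Type*} [TopologicalSpace Y] {s : Set Y} {b : Y → B}
    (hb : ContinuousOn b s) (F : Finset ι) {a : ι → Y → ℝ} {x : ∀ _ : ι, ∀ y, E.Fib (b y)}
    (ha : ∀ i ∈ F, ContinuousOn (a i) s)
    (hx : ∀ i ∈ F, ContinuousOn (fun y => (⟨b y, x i y⟩ : E.Total)) s) :
    ContinuousOn (fun y => (⟨b y, ∑ i ∈ F, a i y • x i y⟩ : E.Total)) s :=
  fun y hy => continuousWithinAt_sum (hb y hy) F (fun i hi => ha i hi y hy)
    (fun i hi => hx i hi y hy)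

lemma FrameSpace.eval_eq_sum (p : E.FrameSpace) (x : Euc n) :
    p.eval x = ⟨p.1, ∑ i, x i • p.2.iso (stdVec i)⟩ := by
  simp only [← map_smul, ← map_sum, sum_smul_stdVec]
  rfl

lemma FrameSpace.continuous_eval :
    Continuous fun z : E.FrameSpace × Euc n => z.1.eval z.2 := by
  simp only [FrameSpace.eval_eq_sum, ← continuousOn_univ]
  refine continuousOn_sum (b := fun z : E.FrameSpace × Euc n => z.1.1)
    (FrameSpace.continuous_fst.comp _root_.continuous_fst).continuousOn _ (fun i _ => ?_)
    (fun i _ => ?_)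
  · exact Continuous.continuousOn (by fun_prop)
  · exact ((FrameSpace.continuous_eval_right (stdVec i)).comp
      _root_.continuous_fst).continuousOn

open Classical in
variable (E) in
/-- The inner product of two points of the total space in the same fibre. -/
noncomputable def totalInner (z w : E.Total) : ℝ :=
  if h : w.1 = z.1 then inner ℝ z.2 (h ▸ w.2) else 0

@[simp] lemma totalInner_mk (b : B) (x y : E.Fib b) :
    E.totalInner ⟨b, x⟩ ⟨b, y⟩ = inner ℝ x y := by
  simp [totalInner]

lemma continuous_totalInner {Y : Type*} [TopologicalSpace Y] {z w : Y → E.Total}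
    (hz : Continuous z) (hw : Continuous w) (h : ∀ y, (w y).1 = (z y).1) :
    Continuous fun y => E.totalInner (z y) (w y) := by
  have hw' : (fun y => (⟨(z y).1, h y ▸ (w y).2⟩ : E.Total)) = w := by
    funext y
    have key : ∀ (z w : E.Total) (h : w.1 = z.1), (⟨z.1, h ▸ w.2⟩ : E.Total) = w := by
      rintro ⟨b, x⟩ ⟨b', x'⟩ h
      obtain rfl : b' = b := h
      rfl
    exact key _ _ (h y)
  have := Continuous.inner_bundle (F := Euc n) (E := E.Fib) (b := fun y => (z y).1)
    (v := fun y => (z y).2) (w := fun y => h y ▸ (w y).2) hz (by rwa [hw'])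
  convert! this using 2 with y
  rw [totalInner, dif_pos (h y)]

open Classical in
/-- The special orthogonal matrix by which two points in a fibre of the frame bundle differ. -/
noncomputable def FrameSpace.diff (p p' : E.FrameSpace) : SO n :=
  if h : p.1 = p'.1 then (h ▸ p.2 : E.Frame p'.1).diff p'.2 else 1

lemma FrameSpace.eval_diff {p p' : E.FrameSpace} (h : p.1 = p'.1) (x : Euc n) :
    p.eval (SO.isometry (FrameSpace.diff p p') x) = p'.eval x := by
  obtain ⟨b, p⟩ := p
  obtain ⟨b', p'⟩ := p'
  obtain rfl : b = b' := h
  simp only [FrameSpace.diff, dite_true, FrameSpace.eval, Frame.apply_diff]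

lemma FrameSpace.ext {p p' : E.FrameSpace} (h : ∀ x, p.eval x = p'.eval x) : p = p' := by
  obtain ⟨b, p⟩ := p
  obtain ⟨b', p'⟩ := p'
  obtain rfl : b = b' := congrArg TotalSpace.proj (h 0)
  have h' : p = p' := Frame.ext' fun x => by
    have := h x
    simp only [FrameSpace.eval] at this
    exact TotalSpace.mk_inj.1 this
  rw [h']

lemma FrameSpace.diff_apply {p p' : E.FrameSpace} (h : p.1 = p'.1) (i j : Fin n) :
    (FrameSpace.diff p p').1 i j = E.totalInner (p.eval (stdVec i)) (p'.eval (stdVec j)) := by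
  obtain ⟨b, p⟩ := p
  obtain ⟨b', p'⟩ := p'
  obtain rfl : b = b' := h
  simp only [FrameSpace.diff, dite_true, FrameSpace.eval, totalInner_mk]
  exact Frame.matrixOf_apply _ _ _ _ _ _

/-- The matrix entries are inner products of the vectors of the two frames. -/
lemma FrameSpace.continuousOn_diff : ContinuousOn
    (fun z : E.FrameSpace × E.FrameSpace => FrameSpace.diff z.1 z.2) {z | z.1.1 = z.2.1} := by
  rw [continuousOn_iff_continuous_domRestrict]
  refine Continuous.subtype_mk (continuous_matrix fun i j => ?_) _
  have h1 : ∀ z : {z : E.FrameSpace × E.FrameSpace | z.1.1 = z.2.1},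
      (FrameSpace.diff z.1.1 z.1.2).1 i j =
        E.totalInner (z.1.1.eval (stdVec i)) (z.1.2.eval (stdVec j)) := fun z =>
    FrameSpace.diff_apply z.2 i j
  change Continuous fun z : {z : E.FrameSpace × E.FrameSpace | z.1.1 = z.2.1} =>
    (FrameSpace.diff z.1.1 z.1.2).1 i j
  simp only [h1]
  refine continuous_totalInner ?_ ?_ fun z => z.2.symm
  · exact (FrameSpace.continuous_eval_right _).comp
      (_root_.continuous_fst.comp continuous_subtype_val)
  · exact (FrameSpace.continuous_eval_right _).comp
      (_root_.continuous_snd.comp continuous_subtype_val)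

/-- The action of `SO n` on the frame bundle. -/
noncomputable def FrameSpace.act (p : E.FrameSpace) (A : SO n) : E.FrameSpace := ⟨p.1, p.2.act A⟩

@[simp] lemma FrameSpace.eval_act (p : E.FrameSpace) (A : SO n) (x : Euc n) :
    (p.act A).eval x = p.eval (SO.isometry A x) := rfl

lemma FrameSpace.continuous_act :
    Continuous fun z : E.FrameSpace × SO n => z.1.act z.2 := by
  rw [continuous_frameSpace_iff]
  intro x
  exact FrameSpace.continuous_eval.comp (_root_.continuous_fst.prodMk
    (SO.continuous_isometry.comp (continuous_snd.prodMk continuous_const)))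

open InnerProductSpace in
lemma continuousOn_gramSchmidt {s : Set B} {f : ∀ b, Fin n → E.Fib b}
    (hf : ∀ i, ContinuousOn (fun b => (⟨b, f b i⟩ : E.Total)) s)
    (hli : ∀ b ∈ s, LinearIndependent ℝ (f b)) (i : Fin n) :
    ContinuousOn (fun b => (⟨b, gramSchmidt ℝ (f b) i⟩ : E.Total)) s := by
  induction i using WellFoundedLT.induction with
  | ind i ih =>
    -- The index `none` stands for the original vector, and `some j` for the projection subtracted
    -- from it, so that the recursion is a single finite sum.
    let a : Option (Fin n) → B → ℝ := fun o b => o.elim 1 fun j =>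
      -(inner ℝ (gramSchmidt ℝ (f b) j) (f b i) /
        inner ℝ (gramSchmidt ℝ (f b) j) (gramSchmidt ℝ (f b) j))
    let x : Option (Fin n) → ∀ b, E.Fib b := fun o b => o.elim (f b i) (gramSchmidt ℝ (f b))
    have hx : ∀ o ∈ Finset.insertNone (Finset.Iio i),
        ContinuousOn (fun b => (⟨b, x o b⟩ : E.Total)) s := by
      rintro (_ | j) hj
      · exact hf i
      · exact ih j (by simpa using hj)
    have ha : ∀ o ∈ Finset.insertNone (Finset.Iio i), ContinuousOn (a o) s := by
      rintro (_ | j) hj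
      · exact continuousOn_const
      · have hj' := ih j (by simpa using hj)
        refine ((ContinuousOn.inner_bundle hj' (hf i)).div (ContinuousOn.inner_bundle hj' hj')
          fun b hb => ?_).neg
        rw [inner_self_ne_zero]
        exact gramSchmidt_ne_zero j (hli b hb)
    refine (continuousOn_sum (b := fun b => b) continuousOn_id _ ha hx).congr fun b _ => ?_
    congr 1
    rw [Finset.sum_insertNone, gramSchmidt_def]
    simp only [a, x, Option.elim, one_smul, neg_smul, Finset.sum_neg_distrib, sub_eq_add_neg]
    congr 2
    refine Finset.sum_congr rfl fun j _ => ?_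
    rw [Submodule.starProjection_singleton, real_inner_self_eq_norm_sq]
    rfl

open InnerProductSpace in
-- Gram–Schmidt turns the basis from an oriented trivialization into an orthonormal one
-- continuously. The change of basis is triangular with positive diagonal, so the orientation
-- survives.
lemma exists_continuousOn_frame (b₀ : B) : ∃ U, IsOpen U ∧ b₀ ∈ U ∧ ∃ s : B → E.FrameSpace,
    ContinuousOn s U ∧ ∀ c ∈ U, (s c).1 = c := by
  classical
  obtain ⟨e, he, hb₀, hor⟩ := E.orient_continuous b₀
  let f : ∀ b, Fin n → E.Fib b := fun b i => e.symm b (stdVec i)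
  let bas : ∀ b ∈ e.baseSet, Module.Basis (Fin n) ℝ (E.Fib b) := fun b hb =>
    (EuclideanSpace.basisFun (Fin n) ℝ).toBasis.map (e.linearEquivAt ℝ b hb).symm
  have hbas : ∀ b hb, ⇑(bas b hb) = f b := fun b hb => by
    funext i
    simp only [bas, Module.Basis.map_apply, OrthonormalBasis.coe_toBasis,
      EuclideanSpace.basisFun_apply]
    rfl
  have hli : ∀ b ∈ e.baseSet, LinearIndependent ℝ (f b) := fun b hb => by
    rw [← hbas b hb]; exact (bas b hb).linearIndependent
  have hor' : ∀ b hb, (bas b hb).orientation = E.orient b := fun b hb => by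
    rw [Module.Basis.orientation_map]
    change Orientation.map (Fin n) (e.linearEquivAt ℝ b hb).symm (stdOrientation n) = _
    rw [← hor b hb, ← Orientation.map_symm, Equiv.symm_apply_apply]
  have hfin : ∀ b ∈ e.baseSet, FiniteDimensional ℝ (E.Fib b) := fun b hb =>
    (bas b hb).finiteDimensional_of_finite
  have hrank : ∀ b ∈ e.baseSet, Module.finrank ℝ (E.Fib b) = Fintype.card (Fin n) :=
    fun b hb => Module.finrank_eq_card_basis (bas b hb)
  let g : ∀ b ∈ e.baseSet, OrthonormalBasis (Fin n) ℝ (E.Fib b) := fun b hb =>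
    haveI := hfin b hb
    gramSchmidtOrthonormalBasis (hrank b hb) (f b)
  have hg : ∀ b hb i, g b hb i = gramSchmidtNormed ℝ (f b) i := fun b hb i => by
    have := hfin b hb
    refine gramSchmidtOrthonormalBasis_apply (hrank b hb) fun h => ?_
    have := gramSchmidtNormed_unit_length (𝕜 := ℝ) i (hli b hb)
    rw [h] at this
    simp at this
  have hgo : ∀ b hb, (g b hb).toBasis.orientation = E.orient b := fun b hb => by
    rw [← hor' b hb, Module.Basis.orientation_eq_iff_det_pos, hbas b hb]
    have := hfin b hb
    change 0 < (gramSchmidtOrthonormalBasis (hrank b hb) (f b)).toBasis.det (f b)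
    rw [gramSchmidtOrthonormalBasis_det]
    refine Finset.prod_pos fun i _ => ?_
    change 0 < inner ℝ (g b hb i) (f b i)
    have h0 := gramSchmidt_ne_zero (𝕜 := ℝ) i (hli b hb)
    have h1 : inner ℝ (gramSchmidt ℝ (f b) i) (f b i) = ‖gramSchmidt ℝ (f b) i‖ ^ 2 := by
      conv_lhs => rw [gramSchmidt_def'' ℝ (f b) i]
      rw [inner_add_right, inner_sum, real_inner_self_eq_norm_sq, Finset.sum_eq_zero, add_zero]
      intro j hj
      rw [inner_smul_right, gramSchmidt_orthogonal ℝ (f b) (Finset.mem_Iio.1 hj).ne', mul_zero]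
    rw [hg b hb, gramSchmidtNormed, real_inner_smul_left, h1]
    have := norm_pos_iff.2 h0
    positivity
  -- The value outside the base set is arbitrary; the frame at `b₀` is a convenient one.
  let s : B → E.FrameSpace := fun b => if hb : b ∈ e.baseSet then
      ⟨b, Frame.ofBasis (g b hb) (hgo b hb)⟩ else ⟨b₀, Frame.ofBasis (g b₀ hb₀) (hgo b₀ hb₀)⟩
  have hs0 : ∀ b hb, s b = ⟨b, Frame.ofBasis (g b hb) (hgo b hb)⟩ := fun b hb => dif_pos hb
  have hs : ∀ b ∈ e.baseSet, ∀ x, (s b).eval x =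
      ⟨b, ∑ i, (x i * ‖gramSchmidt ℝ (f b) i‖⁻¹) • gramSchmidt ℝ (f b) i⟩ := fun b hb x => by
    rw [hs0 b hb]
    change (⟨b, (g b hb).repr.symm x⟩ : E.Total) = _
    congr 1
    rw [← OrthonormalBasis.sum_repr_symm]
    refine Finset.sum_congr rfl fun i _ => ?_
    rw [hg b hb, gramSchmidtNormed, mul_smul]
    rfl
  refine ⟨e.baseSet, e.open_baseSet, hb₀, s, ?_, fun c hc => by rw [hs0 c hc]⟩
  have hf : ∀ i, ContinuousOn (fun b => (⟨b, f b i⟩ : E.Total)) e.baseSet := fun i =>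
    e.continuousOn_symm.comp (Continuous.prodMk_left (stdVec i)).continuousOn
      fun b hb => ⟨hb, trivial⟩
  rw [continuousOn_frameSpace_iff]
  intro x
  refine ContinuousOn.congr ?_ fun b hb => hs b hb x
  refine continuousOn_sum continuousOn_id _ (fun i _ => continuousOn_const.mul (ContinuousOn.inv₀
    ?_ fun b hb => ?_)) fun i _ => continuousOn_gramSchmidt hf hli i
  · simp only [norm_eq_sqrt_real_inner]
    have := continuousOn_gramSchmidt hf hli i
    exact (ContinuousOn.inner_bundle this this).sqrt
  · exact norm_ne_zero_iff.2 (gramSchmidt_ne_zero i (hli b hb))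

variable (E) in
/-- The principal bundle of frames of `E`. -/
noncomputable def frameBundle : PrincipalBundle E.FrameSpace B (SO n) where
  proj p := p.1
  act := FrameSpace.act
  diff := FrameSpace.diff
  continuous_proj := FrameSpace.continuous_fst
  continuous_act := FrameSpace.continuous_act
  continuousOn_diff := FrameSpace.continuousOn_diff
  proj_act _ _ := rfl
  act_diff p p' h := FrameSpace.ext fun x => by
    rw [FrameSpace.eval_act, FrameSpace.eval_diff h]
  exists_section := exists_continuousOn_frame

end OrientedEuclideanBundle

end FrameBundle

/-! ### Clutching functions, and gauge transformations as twisted maps. -/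

section GaugeGroup

open Matrix

/-- The quotient map from the cylinder to the suspension. -/
def Suspension.proj (X : Type u) [TopologicalSpace X] : C(X × I, Suspension X) :=
  ⟨fun z => Quotient.mk (suspensionSetoid X) z, continuous_quot_mk⟩

lemma Suspension.isQuotientMap_proj (X : Type u) [TopologicalSpace X] :
    IsQuotientMap (Suspension.proj X) := isQuotientMap_quot_mk

lemma Suspension.proj_eq_iff {X : Type u} [TopologicalSpace X] {y y' : X × I} :
    Suspension.proj X y = Suspension.proj X y' ↔
      y = y' ∨ (y.2 = 0 ∧ y'.2 = 0) ∨ (y.2 = 1 ∧ y'.2 = 1) :=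
  ⟨fun h => Quotient.exact h, fun h => Quotient.sound h⟩

namespace OrientedEuclideanBundle

section Frames

variable {B : Type u} [TopologicalSpace B] {n : ℕ} {E : OrientedEuclideanBundle.{u, v} B n}

lemma FrameSpace.eval_injective (p : E.FrameSpace) : Function.Injective p.eval := by
  intro x y h
  exact p.2.iso.injective (TotalSpace.mk_inj.1 h)

/-- The coordinates of a point of the total space in a frame. -/
noncomputable def FrameSpace.coords (p : E.FrameSpace) (z : E.Total) : Euc n :=
  WithLp.toLp 2 fun i => E.totalInner (p.eval (stdVec i)) z

@[simp] lemma FrameSpace.coords_eval (p : E.FrameSpace) (x : Euc n) : p.coords (p.eval x) = x := by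
  obtain ⟨b, p⟩ := p
  ext i
  simp [FrameSpace.coords, FrameSpace.eval, EuclideanSpace.inner_single_left]

lemma FrameSpace.exists_eval_eq (p : E.FrameSpace) {z : E.Total} (h : p.1 = z.1) :
    ∃ x, p.eval x = z := by
  obtain ⟨b, p⟩ := p
  obtain ⟨b', x⟩ := z
  obtain rfl : b = b' := h
  exact ⟨p.iso.symm x, by simp [FrameSpace.eval]⟩

lemma FrameSpace.act_diff {p p' : E.FrameSpace} (h : p.1 = p'.1) :
    p.act (FrameSpace.diff p p') = p' := E.frameBundle.act_diff p p' h

lemma FrameSpace.continuousOn_coords {Y : Type*} [TopologicalSpace Y] {p : Y → E.FrameSpace}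
    {z : Y → E.Total} {s : Set Y} (hp : ContinuousOn p s) (hz : ContinuousOn z s)
    (h : ∀ y ∈ s, (p y).1 = (z y).1) : ContinuousOn (fun y => (p y).coords (z y)) s := by
  rw [continuousOn_iff_continuous_domRestrict] at *
  refine (PiLp.continuous_toLp 2 _).comp (continuous_pi fun i => ?_)
  exact continuous_totalInner ((FrameSpace.continuous_eval_right _).comp hp) hz
    fun y => (h y y.2).symm

/-- The isometry of a fibre that a gauge transformation induces. -/
noncomputable def gaugeFib (h : E.gaugeGroup) (b : B) : E.Fib b ≃ₗᵢ[ℝ] E.Fib b :=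
  h.2.choose b

lemma gaugeFib_orient (h : E.gaugeGroup) (b : B) :
    Orientation.map (Fin n) (gaugeFib h b).toLinearEquiv (E.orient b) = E.orient b :=
  h.2.choose_spec.1 b

lemma gauge_apply (h : E.gaugeGroup) (b : B) (x : E.Fib b) : h.1 ⟨b, x⟩ = ⟨b, gaugeFib h b x⟩ :=
  h.2.choose_spec.2 b x

/-- A gauge transformation, read in a frame. -/
noncomputable def gaugeMatrix (h : E.gaugeGroup) (p : E.FrameSpace) : SO n :=
  p.2.matrixOf p.2 (gaugeFib h p.1) (gaugeFib_orient h p.1)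

lemma eval_gaugeMatrix (h : E.gaugeGroup) (p : E.FrameSpace) (x : Euc n) :
    p.eval (SO.isometry (gaugeMatrix h p) x) = h.1 (p.eval x) := by
  obtain ⟨b, p⟩ := p
  simp only [FrameSpace.eval, gaugeMatrix, Frame.apply_matrixOf, gauge_apply]

lemma gaugeMatrix_eq_of {h : E.gaugeGroup} {p : E.FrameSpace} {A : SO n}
    (hA : ∀ x, p.eval (SO.isometry A x) = h.1 (p.eval x)) : gaugeMatrix h p = A :=
  SO.isometry_injective fun x => p.eval_injective (by rw [eval_gaugeMatrix, hA])

lemma gaugeMatrix_apply (h : E.gaugeGroup) (p : E.FrameSpace) (i j : Fin n) :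
    (gaugeMatrix h p).1 i j = E.totalInner (p.eval (stdVec i)) (h.1 (p.eval (stdVec j))) := by
  obtain ⟨b, p⟩ := p
  simp only [FrameSpace.eval, gauge_apply, totalInner_mk]
  exact Frame.matrixOf_apply _ _ _ _ _ _

lemma gauge_proj (h : E.gaugeGroup) (z : E.Total) : (h.1 z).1 = z.1 := by
  obtain ⟨b, x⟩ := z
  rw [gauge_apply]

lemma gaugeMatrix_mul (h h' : E.gaugeGroup) (p : E.FrameSpace) :
    gaugeMatrix (h * h') p = gaugeMatrix h p * gaugeMatrix h' p :=
  gaugeMatrix_eq_of fun x => by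
    rw [SO.isometry_mul, eval_gaugeMatrix, eval_gaugeMatrix]; rfl

lemma gaugeMatrix_act (h : E.gaugeGroup) (p : E.FrameSpace) (A : SO n) :
    gaugeMatrix h (p.act A) = A⁻¹ * gaugeMatrix h p * A :=
  gaugeMatrix_eq_of fun x => by
    rw [FrameSpace.eval_act, ← SO.isometry_mul, ← mul_assoc, ← mul_assoc, mul_inv_cancel, one_mul,
      SO.isometry_mul, eval_gaugeMatrix, FrameSpace.eval_act]

end Frames

variable {X : Type u} [TopologicalSpace X] {n : ℕ}
  (E : OrientedEuclideanBundle.{u, v} (Suspension X) n)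

/-- A trivialization of the pull-back of `E` to the cylinder that is constant at the bottom, and
constant up to the clutching function at the top. -/
structure Clutching where
  /-- the frames over the cylinder -/
  frame : C(X × I, E.FrameSpace)
  /-- the clutching function -/
  clutch : C(X, SO n)
  /-- the frame at the bottom -/
  bot : E.FrameSpace
  /-- the frame at the top -/
  top : E.FrameSpace
  frame_proj : ∀ y, (frame y).1 = Suspension.proj X y
  frame_zero : ∀ x, frame (x, 0) = bot
  frame_one : ∀ x, frame (x, 1) = top.act (clutch x)

/-- Lift the quotient map to the frame bundle, starting from one frame over the bottom point. At the
top all lifted frames lie in one fibre, and their differences from the frame at `x₀` form the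
clutching function. -/
lemma exists_clutching [Nonempty X] [T2Space X] [ParacompactSpace X] : Nonempty E.Clutching := by
  obtain ⟨x₀⟩ := ‹Nonempty X›
  obtain ⟨U, -, hU, s, -, hs⟩ := E.frameBundle.exists_section (Suspension.proj X (x₀, 0))
  obtain ⟨Φ, h1, h2⟩ := E.frameBundle.exists_lift (Suspension.proj X)
    (ContinuousMap.const X (s (Suspension.proj X (x₀, 0)))) (fun x => by
      rw [ContinuousMap.const_apply, hs _ hU, Suspension.proj_eq_iff]
      exact Or.inr (Or.inl ⟨rfl, rfl⟩))
  have htop : ∀ x, (Φ (x₀, 1)).1 = (Φ (x, 1)).1 := fun x => by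
    refine (h1 (x₀, 1)).trans (Eq.trans ?_ (h1 (x, 1)).symm)
    rw [Suspension.proj_eq_iff]
    exact Or.inr (Or.inr ⟨rfl, rfl⟩)
  refine ⟨⟨Φ, ⟨fun x => FrameSpace.diff (Φ (x₀, 1)) (Φ (x, 1)), ?_⟩, _, Φ (x₀, 1), h1, h2,
    fun x => (FrameSpace.act_diff (htop x)).symm⟩⟩
  exact FrameSpace.continuousOn_diff.comp_continuous
    (f := fun x => (Φ (x₀, 1), Φ (x, 1))) (by fun_prop) htop

namespace Clutching

variable {E} (C : E.Clutching)

/-- A gauge transformation, read in the frames over the cylinder. -/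
noncomputable def pull (h : E.gaugeGroup) : C(X × I, SO n) where
  toFun y := gaugeMatrix h (C.frame y)
  continuous_toFun := by
    refine Continuous.subtype_mk (f := fun y => (gaugeMatrix h (C.frame y)).1)
      (continuous_matrix fun i j => ?_) _
    simp only [gaugeMatrix_apply]
    exact continuous_totalInner ((FrameSpace.continuous_eval_right _).comp C.frame.continuous)
      (h.1.continuous.comp ((FrameSpace.continuous_eval_right _).comp C.frame.continuous))
      fun y => gauge_proj h _

lemma pull_apply (h : E.gaugeGroup) (y : X × I) : C.pull h y = gaugeMatrix h (C.frame y) := rfl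

lemma pull_mem (h : E.gaugeGroup) : C.pull h ∈ twistedMaps C.clutch :=
  ⟨⟨gaugeMatrix h C.bot, fun x => by rw [pull_apply, frame_zero]⟩, gaugeMatrix h C.top, fun x => by
    rw [pull_apply, frame_one, gaugeMatrix_act]; simp [mul_assoc]⟩

lemma exists_eval_eq (z : E.Total) : ∃ y x, (C.frame y).eval x = z := by
  obtain ⟨y, hy⟩ := (Suspension.isQuotientMap_proj X).surjective z.1
  obtain ⟨x, hx⟩ := (C.frame y).exists_eval_eq ((C.frame_proj y).trans hy)
  exact ⟨y, x, hx⟩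

/-- A point of the cylinder over a given point of the suspension. -/
noncomputable def lift (b : Suspension X) : X × I :=
  Function.surjInv (Suspension.isQuotientMap_proj X).surjective b

lemma proj_lift (b : Suspension X) : Suspension.proj X (lift b) = b :=
  Function.surjInv_eq _ b

/-- The map of the total space that is given by `f` in the frames over the cylinder. -/
noncomputable def twist (f : C(X × I, SO n)) (z : E.Total) : E.Total :=
  (C.frame (lift z.1)).eval (SO.isometry (f (lift z.1)) ((C.frame (lift z.1)).coords z))

/-- The result does not depend on the chosen lift. Only the two ends need an argument: at the bottom
frame and matrix are constant, and at the top the change of frame is absorbed by the conjugation in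
the twisting condition. -/
lemma twist_eval {f : C(X × I, SO n)} (hf : f ∈ twistedMaps C.clutch) (y : X × I) (x : Euc n) :
    C.twist f ((C.frame y).eval x) = (C.frame y).eval (SO.isometry (f y) x) := by
  have hy : Suspension.proj X (lift ((C.frame y).eval x).1) = Suspension.proj X y := by
    rw [proj_lift]; exact C.frame_proj y
  rw [twist]
  generalize lift ((C.frame y).eval x).1 = y' at hy
  rcases Suspension.proj_eq_iff.1 hy with h | ⟨h0, h0'⟩ | ⟨h1, h1'⟩
  · rw [h, FrameSpace.coords_eval]
  · obtain ⟨a, t⟩ := y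
    obtain ⟨a', t'⟩ := y'
    obtain rfl : t' = 0 := h0
    obtain rfl : t = 0 := h0'
    obtain ⟨⟨c, hc⟩, -⟩ := hf
    rw [C.frame_zero, C.frame_zero, FrameSpace.coords_eval, hc, hc]
  · obtain ⟨a, t⟩ := y
    obtain ⟨a', t'⟩ := y'
    obtain rfl : t' = 1 := h1
    obtain rfl : t = 1 := h1'
    obtain ⟨-, c, hc⟩ := hf
    have h2 : (C.top.act (C.clutch a)).eval x =
        (C.top.act (C.clutch a')).eval (SO.isometry ((C.clutch a')⁻¹ * C.clutch a) x) := by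
      rw [FrameSpace.eval_act, FrameSpace.eval_act, ← SO.isometry_mul, mul_inv_cancel_left]
    rw [C.frame_one, C.frame_one, h2, FrameSpace.coords_eval, FrameSpace.eval_act,
      FrameSpace.eval_act, ← SO.isometry_mul, ← SO.isometry_mul, ← SO.isometry_mul]
    congr 2
    have h3 : C.clutch a' * f (a', 1) * (C.clutch a')⁻¹ = C.clutch a * f (a, 1) * (C.clutch a)⁻¹ :=
      (hc a').trans (hc a).symm
    congr 1
    calc C.clutch a' * f (a', 1) * ((C.clutch a')⁻¹ * C.clutch a)
      _ = C.clutch a' * f (a', 1) * (C.clutch a')⁻¹ * C.clutch a := by simp only [mul_assoc]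
      _ = C.clutch a * f (a, 1) := by rw [h3, inv_mul_cancel_right]

lemma twist_mul {f f' : C(X × I, SO n)} (hf : f ∈ twistedMaps C.clutch)
    (hf' : f' ∈ twistedMaps C.clutch) (z : E.Total) :
    C.twist (f * f') z = C.twist f (C.twist f' z) := by
  obtain ⟨y, x, rfl⟩ := C.exists_eval_eq z
  rw [C.twist_eval (mul_mem hf hf'), C.twist_eval hf', C.twist_eval hf, ← SO.isometry_mul]
  rfl

lemma twist_one (z : E.Total) : C.twist 1 z = z := by
  obtain ⟨y, x, rfl⟩ := C.exists_eval_eq z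
  rw [C.twist_eval (one_mem _)]
  change (C.frame y).eval (SO.isometry (1 : SO n) x) = _
  rw [SO.isometry_one]

lemma twist_pull (h : E.gaugeGroup) (z : E.Total) : C.twist (C.pull h) z = h.1 z := by
  obtain ⟨y, x, rfl⟩ := C.exists_eval_eq z
  rw [C.twist_eval (C.pull_mem h), pull_apply, eval_gaugeMatrix]

/-- The chosen lift is not continuous, so the map is read in a continuous local frame `sec` over
`U`. Its matrix there descends from a continuous function on the cylinder. -/
lemma continuous_twist {T : Type*} [TopologicalSpace T] [LocallyCompactSpace T]
    (F : C(T × (X × I), SO n)) (hF : ∀ s, F.curry s ∈ twistedMaps C.clutch) :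
    Continuous fun z : T × E.Total => C.twist (F.curry z.1) z.2 := by
  rw [continuous_iff_continuousAt]
  rintro ⟨s₀, z₀⟩
  obtain ⟨U, hU, hb, sec, h_sec, h_secU⟩ := E.frameBundle.exists_section z₀.1
  replace h_secU : ∀ c ∈ U, (sec c).1 = c := h_secU
  let M : T → X × I → SO n := fun s y =>
    FrameSpace.diff (sec (Suspension.proj X y)) (C.frame y) * F (s, y) *
      FrameSpace.diff (C.frame y) (sec (Suspension.proj X y))
  have hM : ∀ s y x, Suspension.proj X y ∈ U →
      C.twist (F.curry s) ((sec (Suspension.proj X y)).eval x) =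
      (sec (Suspension.proj X y)).eval (SO.isometry (M s y) x) := by
    intro s y x hy
    have h1 : (sec (Suspension.proj X y)).1 = (C.frame y).1 := by rw [h_secU _ hy, C.frame_proj]
    rw [← FrameSpace.eval_diff h1.symm x, C.twist_eval (hF s), SO.isometry_mul, SO.isometry_mul,
      FrameSpace.eval_diff h1]
    rfl
  let m : T × U → SO n := fun z => M z.1 (lift z.2.1)
  have hm : ∀ s y (hy : Suspension.proj X y ∈ U), m (s, ⟨Suspension.proj X y, hy⟩) = M s y := by
    intro s y hy
    refine SO.isometry_injective fun x => (sec (Suspension.proj X y)).eval_injective ?_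
    rw [← hM s y x hy]
    have h2 : Suspension.proj X (lift (Suspension.proj X y)) = Suspension.proj X y := proj_lift _
    have h3 := hM s (lift (Suspension.proj X y)) x (by rwa [h2])
    rw [h2] at h3
    exact h3.symm
  have hmc : Continuous m := by
    have hq := (Suspension.isQuotientMap_proj X).restrictPreimage_isOpen hU
    -- Local compactness of `T` makes the product of `T` with a quotient map a quotient map.
    refine hq.continuous_lift_prod_right (g := m) ?_
    have h4 : (fun p : T × (Suspension.proj X ⁻¹' U) =>
        m (p.1, U.restrictPreimage (Suspension.proj X) p.2)) = fun p => M p.1 p.2.1 := by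
      funext p
      exact hm p.1 p.2.1 p.2.2
    rw [h4]
    have hs : Continuous fun y : Suspension.proj X ⁻¹' U => sec (Suspension.proj X y.1) :=
      h_sec.comp_continuous ((Suspension.proj X).continuous.comp continuous_subtype_val)
        fun y => y.2
    have hf : Continuous fun y : Suspension.proj X ⁻¹' U => C.frame y.1 :=
      C.frame.continuous.comp continuous_subtype_val
    have hb : ∀ y : Suspension.proj X ⁻¹' U,
        (sec (Suspension.proj X y.1)).1 = (C.frame y.1).1 := fun y => by
      rw [h_secU _ y.2, C.frame_proj]
    have hd1 : Continuous fun y : Suspension.proj X ⁻¹' U =>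
        FrameSpace.diff (sec (Suspension.proj X y.1)) (C.frame y.1) :=
      FrameSpace.continuousOn_diff.comp_continuous (hs.prodMk hf) hb
    have hd2 : Continuous fun y : Suspension.proj X ⁻¹' U =>
        FrameSpace.diff (C.frame y.1) (sec (Suspension.proj X y.1)) :=
      FrameSpace.continuousOn_diff.comp_continuous (hf.prodMk hs) fun y => (hb y).symm
    exact ((hd1.comp continuous_snd).mul (F.continuous.comp (continuous_fst.prodMk
      (continuous_subtype_val.comp continuous_snd)))).mul (hd2.comp continuous_snd)
  let W : Set (T × E.Total) := {z | z.2.1 ∈ U}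
  have hpr : Continuous fun z : T × E.Total => z.2.1 :=
    (FiberBundle.continuous_proj (Euc n) E.Fib).comp continuous_snd
  have hW : IsOpen W := hU.preimage hpr
  refine ContinuousOn.continuousAt (s := W) ?_ (hW.mem_nhds hb)
  have h_secW : ContinuousOn (fun z : T × E.Total => sec z.2.1) W :=
    h_sec.comp hpr.continuousOn fun z hz => hz
  have hcW : ContinuousOn (fun z : T × E.Total => (sec z.2.1).coords z.2) W :=
    FrameSpace.continuousOn_coords h_secW continuousOn_snd fun z hz => h_secU _ hz
  have hmW : ContinuousOn (fun z : T × E.Total => M z.1 (lift z.2.1)) W := by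
    rw [continuousOn_iff_continuous_domRestrict]
    exact hmc.comp (f := fun z : W => (z.1.1, (⟨z.1.2.1, z.2⟩ : U)))
      ((continuous_fst.comp continuous_subtype_val).prodMk
        (Continuous.subtype_mk (hpr.comp continuous_subtype_val) _))
  refine ContinuousOn.congr (f := fun z : T × E.Total => (sec z.2.1).eval
    (SO.isometry (M z.1 (lift z.2.1)) ((sec z.2.1).coords z.2))) ?_ ?_
  · exact FrameSpace.continuous_eval.comp_continuousOn (h_secW.prodMk
      (SO.continuous_isometry.comp_continuousOn (hmW.prodMk hcW)))
  · rintro ⟨s, z⟩ hz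
    have h5 := proj_lift z.1
    obtain ⟨x, hx⟩ := (sec z.1).exists_eval_eq (h_secU _ hz)
    have h6 := hM s (lift z.1) x (by rw [h5]; exact hz)
    rw [h5, hx] at h6
    have h7 : (sec z.1).coords z = x := by rw [← FrameSpace.coords_eval (sec z.1) x, hx]
    change C.twist (F.curry s) z =
      (sec z.1).eval (SO.isometry (M s (lift z.1)) ((sec z.1).coords z))
    rw [h6, h7]

lemma continuous_twist_const {f : C(X × I, SO n)} (hf : f ∈ twistedMaps C.clutch) :
    Continuous (C.twist f) := by
  have h := C.continuous_twist (T := Unit) (f.comp ContinuousMap.snd) fun s => by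
    exact hf
  exact h.comp (Continuous.prodMk_right ())

end Clutching

end OrientedEuclideanBundle

end GaugeGroup

/-! ### Components of the gauge group, homotopy classes, and the final count. -/

section Counting

namespace OrientedEuclideanBundle.Clutching

variable {X : Type u} [TopologicalSpace X] {n : ℕ}
  {E : OrientedEuclideanBundle.{u, v} (Suspension X) n} (C : E.Clutching)

lemma exists_twist_fib {f : C(X × I, SO n)} (hf : f ∈ twistedMaps C.clutch) (b : Suspension X) :
    ∃ φ : E.Fib b ≃ₗᵢ[ℝ] E.Fib b,
      Orientation.map (Fin n) φ.toLinearEquiv (E.orient b) = E.orient b ∧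
      ∀ x : E.Fib b, C.twist f ⟨b, x⟩ = ⟨b, φ x⟩ := by
  obtain ⟨y, hy⟩ := (Suspension.isQuotientMap_proj X).surjective b
  have ht := C.twist_eval hf y
  have hp : (C.frame y).1 = b := (C.frame_proj y).trans hy
  generalize C.frame y = p at ht hp
  obtain ⟨b', p⟩ := p
  obtain rfl : b' = b := hp
  refine ⟨p.iso.symm.trans (p.act (f y)).iso, ?_, fun x => ?_⟩
  · conv_rhs => rw [← (p.act (f y)).map_orient]
    conv_lhs => rw [← p.map_orient]
    refine (Orientation.map_trans' p.iso.toLinearEquiv.symm (p.act (f y)).iso.toLinearEquiv _).trans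
      (congrArg _ ?_)
    exact (Orientation.map (Fin n) p.iso.toLinearEquiv).symm_apply_apply _
  · have h := ht (p.iso.symm x)
    simp only [FrameSpace.eval, p.iso.apply_symm_apply] at h
    exact h

/-- The gauge group is the group of twisted maps on the cylinder. -/
noncomputable def gaugeEquiv : E.gaugeGroup ≃* twistedMaps C.clutch where
  toFun h := ⟨C.pull h, C.pull_mem h⟩
  invFun f := ⟨{  toFun := C.twist f.1
                  invFun := C.twist f⁻¹.1
                  left_inv := fun z => by
                    rw [← C.twist_mul f⁻¹.2 f.2, ← Subgroup.coe_mul, inv_mul_cancel,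
                      Subgroup.coe_one, C.twist_one]
                  right_inv := fun z => by
                    rw [← C.twist_mul f.2 f⁻¹.2, ← Subgroup.coe_mul, mul_inv_cancel,
                      Subgroup.coe_one, C.twist_one]
                  continuous_toFun := C.continuous_twist_const f.2
                  continuous_invFun := C.continuous_twist_const f⁻¹.2 }, by
    choose φ h1 h2 using C.exists_twist_fib f.2
    exact ⟨φ, h1, h2⟩⟩
  left_inv h := Subtype.ext (Homeomorph.ext fun z => C.twist_pull h z)
  right_inv f := Subtype.ext (ContinuousMap.ext fun y =>
    gaugeMatrix_eq_of fun x => (C.twist_eval f.2 y x).symm)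
  map_mul' h h' := Subtype.ext (ContinuousMap.ext fun y => gaugeMatrix_mul h h' _)

@[simp] lemma coe_gaugeEquiv (h : E.gaugeGroup) : (C.gaugeEquiv h).1 = C.pull h := rfl

lemma pull_gaugeEquiv_symm (f : twistedMaps C.clutch) : C.pull (C.gaugeEquiv.symm f) = f.1 := by
  rw [← coe_gaugeEquiv, MulEquiv.apply_symm_apply]

lemma continuous_of_pull {T : Type*} [TopologicalSpace T] [LocallyCompactSpace T]
    {ψ : T → E.gaugeGroup} (F : C(T × (X × I), SO n)) (h : ∀ s, C.pull (ψ s) = F.curry s) :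
    Continuous ψ := by
  refine continuous_induced_rng.2 ?_
  have hF : ∀ s, F.curry s ∈ twistedMaps C.clutch := fun s => by rw [← h]; exact C.pull_mem _
  refine (ContinuousMap.curry ⟨_, C.continuous_twist F hF⟩).continuous.congr fun s => ?_
  ext1 z
  change C.twist (F.curry s) z = (ψ s).1 z
  rw [← h, twist_pull]

/-- Evaluation is only needed along maps from `L` to the total space, so local compactness of `L`
suffices to uncurry; none is assumed of the total space. -/
lemma continuous_pull_comp {T L : Type*} [TopologicalSpace T] [TopologicalSpace L]
    [LocallyCompactSpace L] {ψ : T → E.gaugeGroup} (hψ : Continuous ψ) {j : L → X × I}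
    (hj : Continuous j) : Continuous fun z : T × L => C.pull (ψ z.1) (j z.2) := by
  refine Continuous.subtype_mk (f := fun z : T × L => (gaugeMatrix (ψ z.1) (C.frame (j z.2))).1)
      (continuous_matrix fun a b => ?_) _
  simp only [gaugeMatrix_apply]
  have hk : ∀ a, Continuous fun l => (C.frame (j l)).eval (stdVec a) := fun a =>
    (FrameSpace.continuous_eval_right _).comp (C.frame.continuous.comp hj)
  refine continuous_totalInner ((hk a).comp continuous_snd) ?_ fun z => gauge_proj _ _
  let k : C(L, E.Total) := ⟨_, hk b⟩
  have h1 : Continuous fun s : T => ((ψ s).1 : C(E.Total, E.Total)).comp k :=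
    (ContinuousMap.continuous_precomp k).comp (continuous_induced_dom.comp hψ)
  exact ContinuousMap.continuous_uncurry_of_continuous ⟨_, h1⟩

/-- Compact generation of `X` reduces continuity of `X → C(T × I, SO n)` to compact subsets, where
`continuous_pull_comp` applies. -/
lemma continuous_pull [T2Space X] [CompactlyCoherentSpace X] {T : Type*} [TopologicalSpace T]
    [LocallyCompactSpace T] {ψ : T → E.gaugeGroup} (hψ : Continuous ψ) :
    Continuous fun z : T × (X × I) => C.pull (ψ z.1) z.2 := by
  let Φ : X → C(T × I, SO n) := fun x =>
    ⟨fun z => C.pull (ψ z.1) (x, z.2), C.continuous_pull_comp hψ (Continuous.prodMk_right x)⟩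
  have hΦ : Continuous Φ := by
    rw [CompactlyCoherentSpace.isCoherentWith.continuous_iff]
    intro K hK
    rw [continuousOn_iff_continuous_domRestrict]
    have : CompactSpace K := isCompact_iff_compactSpace.1 hK
    have h1 : Continuous fun z : T × (K × I) => C.pull (ψ z.1) (z.2.1.1, z.2.2) :=
      C.continuous_pull_comp hψ (j := fun z : K × I => (z.1.1, z.2)) (by fun_prop)
    have h2 : Continuous fun z : K × (T × I) => C.pull (ψ z.2.1) (z.1.1, z.2.2) :=
      h1.comp (f := fun z : K × (T × I) => (z.2.1, (z.1, z.2.2))) (by fun_prop)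
    exact (ContinuousMap.curry ⟨_, h2⟩).continuous
  have h3 := ContinuousMap.continuous_uncurry_of_continuous ⟨Φ, hΦ⟩
  exact h3.comp (f := fun z : T × (X × I) => (z.2.1, (z.1, z.2.2))) (by fun_prop)

/-- Paths for the compact-open topology correspond to jointly continuous families on the cylinder,
by `continuous_pull` one way and `continuous_of_pull` the other. -/
lemma joined_iff [T2Space X] [CompactlyCoherentSpace X] (h h' : E.gaugeGroup) :
    Joined h h' ↔ (C.pull h)⁻¹ * C.pull h' ∈ nullHomotopicIn (twistedMaps C.clutch) := by
  constructor
  · rintro ⟨γ⟩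
    have hγ := C.continuous_pull γ.continuous
    have hc : Continuous fun z : I × (X × I) => (C.pull h z.2)⁻¹ * C.pull (γ z.1) z.2 :=
      ((C.pull h).continuous.comp continuous_snd).inv.mul hγ
    refine ⟨⟨_, hc⟩, fun y => ?_, fun y => ?_, fun s => ?_⟩
    · refine (congrArg (fun g => (C.pull h y)⁻¹ * C.pull g y) γ.source).trans ?_
      exact inv_mul_cancel _
    · exact congrArg (fun g => (C.pull h y)⁻¹ * C.pull g y) γ.target
    · have h1 := mul_mem (inv_mem (C.pull_mem h)) (C.pull_mem (γ s))
      exact h1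
  · rintro ⟨F, h0, h1, hF⟩
    have hmem : ∀ s, C.pull h * F.curry s ∈ twistedMaps C.clutch := fun s =>
      mul_mem (C.pull_mem h) (hF s)
    let ψ : I → E.gaugeGroup := fun s => C.gaugeEquiv.symm ⟨_, hmem s⟩
    have hψ : ∀ s, C.pull (ψ s) = C.pull h * F.curry s := fun s => C.pull_gaugeEquiv_symm _
    refine ⟨⟨⟨ψ, C.continuous_of_pull ⟨fun z => C.pull h z.2 * F z, by fun_prop⟩ fun s => hψ s⟩,
      ?_, ?_⟩⟩
    · refine C.gaugeEquiv.injective (Subtype.ext ((hψ 0).trans ?_))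
      ext1 y
      change C.pull h y * F (0, y) = C.pull h y
      rw [h0, mul_one]
    · refine C.gaugeEquiv.injective (Subtype.ext ((hψ 1).trans ?_))
      ext1 y
      change C.pull h y * F (1, y) = C.pull h' y
      rw [h1]
      exact mul_inv_cancel_left _ _

lemma card_zerothHomotopy [T2Space X] [CompactlyCoherentSpace X] :
    Nat.card (ZerothHomotopy E.gaugeGroup) = Nat.card (twistedMaps C.clutch ⧸
      (nullHomotopicIn (twistedMaps C.clutch)).subgroupOf (twistedMaps C.clutch)) := by
  refine Nat.card_congr (Quotient.congr C.gaugeEquiv.toEquiv fun h h' => ?_)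
  refine (C.joined_iff h h').trans ?_
  rw [QuotientGroup.leftRel_apply, Subgroup.mem_subgroupOf]
  rfl

lemma isTurnable_iff [PathConnectedSpace (SO n)] [T2Space X] [CompactlyCoherentSpace X]
    (η : Path (1 : SO n) 1) : E.IsTurnable η ↔ IsTurnableTwist C.clutch η := by
  constructor
  · rintro ⟨ψ, hψ⟩
    refine ⟨⟨fun z => C.pull (ψ z.1) z.2, C.continuous_pull ψ.continuous⟩,
      fun s => C.pull_mem (ψ s), fun y => ?_⟩
    obtain ⟨δ, h1, h2⟩ := hψ _ (C.frame y).2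
    exact ⟨δ, fun s => (gaugeMatrix_eq_of fun x => (h1 s x).symm).symm, h2⟩
  · rintro ⟨F, hF, hδ⟩
    let ψ : I → E.gaugeGroup := fun s => C.gaugeEquiv.symm ⟨_, hF s⟩
    have hψ : ∀ s, C.pull (ψ s) = F.curry s := fun s => C.pull_gaugeEquiv_symm _
    have hend : ∀ s, (∀ y, F (s, y) = 1) → ψ s = 1 := fun s hs => by
      refine C.gaugeEquiv.injective (Subtype.ext ((hψ s).trans ?_))
      rw [map_one]
      exact ContinuousMap.ext hs
    refine ⟨⟨⟨ψ, C.continuous_of_pull F hψ⟩, hend 0 fun y => ?_, hend 1 fun y => ?_⟩, ?_⟩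
    · obtain ⟨δ, h1, -⟩ := hδ y
      rw [← h1, δ.source]
    · obtain ⟨δ, h1, -⟩ := hδ y
      rw [← h1, δ.target]
    · intro b p
      obtain ⟨y, hy⟩ := (Suspension.isQuotientMap_proj X).surjective b
      obtain ⟨δ, h1, h2⟩ := hδ y
      let p' : E.FrameSpace := ⟨b, p⟩
      have hp : (C.frame y).1 = p'.1 := (C.frame_proj y).trans hy
      -- An arbitrary frame differs from the cylinder frame by `A`, which conjugates the loop and so
      -- keeps its homotopy class.
      set A := FrameSpace.diff (C.frame y) p' with hA
      refine ⟨conjPath A δ, fun t x => ?_, (conjPath_homotopic A δ).trans h2⟩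
      have h3 : gaugeMatrix (ψ t) p' = conjPath A δ t := by
        rw [← FrameSpace.act_diff hp, gaugeMatrix_act, ← pull_apply, hψ, conjPath_apply, h1]
        rfl
      rw [← h3]
      exact (eval_gaugeMatrix (ψ t) p' x).symm

end OrientedEuclideanBundle.Clutching

section Suspension

variable {X : Type u} [TopologicalSpace X] {G : Type v} [TopologicalSpace G] [Group G]
  [IsTopologicalGroup G]

/-- Maps on the suspension are maps on the cylinder that are constant at both ends. -/
noncomputable def Suspension.mapsEquiv : C(Suspension X, G) ≃ twistedMaps (1 : C(X, G)) where
  toFun f := ⟨f.comp (Suspension.proj X), by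
    refine ⟨?_, ?_⟩
    · by_cases h : Nonempty X
      · obtain ⟨x₀⟩ := h
        refine ⟨f (Suspension.proj X (x₀, 0)), fun x => congrArg f ?_⟩
        exact Suspension.proj_eq_iff.2 (Or.inr (Or.inl ⟨rfl, rfl⟩))
      · exact ⟨1, fun x => (h ⟨x⟩).elim⟩
    · by_cases h : Nonempty X
      · obtain ⟨x₀⟩ := h
        refine ⟨f (Suspension.proj X (x₀, 1)), fun x => ?_⟩
        change 1 * f (Suspension.proj X (x, 1)) * 1⁻¹ = _
        rw [one_mul, inv_one, mul_one]
        exact congrArg f (Suspension.proj_eq_iff.2 (Or.inr (Or.inr ⟨rfl, rfl⟩)))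
      · exact ⟨1, fun x => (h ⟨x⟩).elim⟩⟩
  invFun f := (Suspension.isQuotientMap_proj X).lift f.1 (by
    obtain ⟨f, ⟨a, ha⟩, b, hb⟩ := f
    rintro ⟨x, t⟩ ⟨x', t'⟩ h
    rcases Suspension.proj_eq_iff.1 h with h | ⟨h, h'⟩ | ⟨h, h'⟩
    · rw [h]
    · obtain rfl : t = 0 := h
      obtain rfl : t' = 0 := h'
      exact (ha x).trans (ha x').symm
    · obtain rfl : t = 1 := h
      obtain rfl : t' = 1 := h'
      simpa using (hb x).trans (hb x').symm)
  left_inv f := by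
    ext b
    obtain ⟨y, rfl⟩ := (Suspension.isQuotientMap_proj X).surjective b
    exact DFunLike.congr_fun ((Suspension.isQuotientMap_proj X).lift_comp
      (f.comp (Suspension.proj X)) fun _ _ h => congrArg f h) y
  right_inv f := Subtype.ext ((Suspension.isQuotientMap_proj X).lift_comp _ _)

lemma Suspension.mapsEquiv_apply (f : C(Suspension X, G)) (y : X × I) :
    (Suspension.mapsEquiv f).1 y = f (Suspension.proj X y) := rfl

/-- The analogue of `joined_iff` for trivial clutching; a homotopy on the cylinder descends because
`I` times the quotient map is again a quotient map. -/
lemma Suspension.homotopic_iff (f f' : C(Suspension X, G)) : f.Homotopic f' ↔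
    (Suspension.mapsEquiv f).1⁻¹ * (Suspension.mapsEquiv f').1 ∈
      nullHomotopicIn (twistedMaps (1 : C(X, G))) := by
  constructor
  · rintro ⟨H⟩
    have hc : Continuous fun z : I × (X × I) =>
        (f (Suspension.proj X z.2))⁻¹ * H (z.1, Suspension.proj X z.2) := by
      have := (Suspension.proj X).continuous
      fun_prop
    refine ⟨⟨_, hc⟩, fun y => ?_, fun y => ?_, fun s => ?_⟩
    · change (f (Suspension.proj X y))⁻¹ * H (0, Suspension.proj X y) = 1
      simp
    · change (f (Suspension.proj X y))⁻¹ * H (1, Suspension.proj X y) = _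
      simp [Suspension.mapsEquiv_apply]
    · exact mul_mem (inv_mem (Suspension.mapsEquiv f).2)
        (Suspension.mapsEquiv (H.toContinuousMap.curry s)).2
  · rintro ⟨F, h0, h1, hF⟩
    have hm : ∀ s, (Suspension.mapsEquiv f).1 * F.curry s ∈ twistedMaps (1 : C(X, G)) :=
      fun s => mul_mem (Suspension.mapsEquiv f).2 (hF s)
    let H : I → C(Suspension X, G) := fun s => Suspension.mapsEquiv.symm ⟨_, hm s⟩
    have hH : ∀ s y, H s (Suspension.proj X y) = f (Suspension.proj X y) * F (s, y) := fun s y => by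
      rw [← Suspension.mapsEquiv_apply, Equiv.apply_symm_apply]
      rfl
    have hc : Continuous fun z : I × Suspension X => H z.1 z.2 := by
      refine (Suspension.isQuotientMap_proj X).continuous_lift_prod_right ?_
      simp only [hH]
      exact (f.continuous.comp ((Suspension.proj X).continuous.comp continuous_snd)).mul
        F.continuous
    refine ⟨⟨⟨_, hc⟩, fun b => ?_, fun b => ?_⟩⟩
    · obtain ⟨y, rfl⟩ := (Suspension.isQuotientMap_proj X).surjective b
      change H 0 _ = _
      rw [hH, h0, mul_one]
    · obtain ⟨y, rfl⟩ := (Suspension.isQuotientMap_proj X).surjective b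
      change H 1 _ = _
      rw [hH, h1]
      exact mul_inv_cancel_left _ _

lemma Suspension.card_homotopyClasses : Nat.card (HomotopyClasses (Suspension X) G) =
    Nat.card (twistedMaps (1 : C(X, G)) ⧸
      (nullHomotopicIn (twistedMaps (1 : C(X, G)))).subgroupOf (twistedMaps 1)) := by
  refine Nat.card_congr (Quotient.congr Suspension.mapsEquiv fun f f' => ?_)
  refine (Suspension.homotopic_iff f f').trans ?_
  rw [QuotientGroup.leftRel_apply, Subgroup.mem_subgroupOf]
  rfl

end Suspension

lemma Nat.card_zerothHomotopy_congr {Y Z : Type*} [TopologicalSpace Y] [TopologicalSpace Z]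
    (e : Y ≃ₕ Z) : Nat.card (ZerothHomotopy Y) = Nat.card (ZerothHomotopy Z) := by
  let f : ZerothHomotopy Y → ZerothHomotopy Z :=
    Quotient.map e.toFun fun _ _ h => h.map e.toFun.continuous
  let g : ZerothHomotopy Z → ZerothHomotopy Y :=
    Quotient.map e.invFun fun _ _ h => h.map e.invFun.continuous
  have hgf : ∀ x, g (f x) = x := by
    rintro ⟨x⟩
    obtain ⟨H⟩ := e.left_inv
    exact Quotient.sound ⟨H.evalAt x⟩
  have hfg : ∀ x, f (g x) = x := by
    rintro ⟨x⟩
    obtain ⟨H⟩ := e.right_inv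
    exact Quotient.sound ⟨H.evalAt x⟩
  exact Nat.card_congr ⟨f, g, hgf, hfg⟩

lemma OrientedEuclideanBundle.card_zerothHomotopy_gaugeGroup {X : Type u} [TopologicalSpace X]
    [Nonempty X] [T2Space X] [ParacompactSpace X] [CompactlyCoherentSpace X] {n : ℕ} (hn : 3 ≤ n)
    {η : Path (1 : SO n) 1} (hη : ∀ g : FundamentalGroup (SO n) 1,
      g ∈ Subgroup.zpowers (FundamentalGroup.fromPath (Path.Homotopic.Quotient.mk η)))
    (E : OrientedEuclideanBundle.{u, v} (Suspension X) n) :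
    (E.IsTurnable η → Nat.card (ZerothHomotopy E.gaugeGroup) =
      Nat.card (HomotopyClasses (Suspension X) (SO n))) ∧
    (¬ E.IsTurnable η → 2 * Nat.card (ZerothHomotopy E.gaugeGroup) =
      Nat.card (HomotopyClasses (Suspension X) (SO n))) := by
  have := SO.pathConnectedSpace (n := n) (by omega)
  obtain ⟨C⟩ := E.exists_clutching
  have hη2 := SO.trans_self_homotopic_refl hn η
  rw [C.isTurnable_iff, C.card_zerothHomotopy, Suspension.card_homotopyClasses]
  exact card_twistedMaps (homotopic_refl_or_of_generator hη hη2) hη2 C.clutch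

end Counting

theorem theoremt {X : Type u} [TopologicalSpace X] [Nonempty X] [T2Space X] [ParacompactSpace X]
    [CompactlyCoherentSpace X] (k : ℕ) (hk : 2 ≤ k)
    (η : Path (1 : SO (2 * k)) 1)
    (hη : ∀ g : FundamentalGroup (SO (2 * k)) 1,
      g ∈ Subgroup.zpowers (FundamentalGroup.fromPath (Path.Homotopic.Quotient.mk η)))
    [Finite (HomotopyClasses (Suspension X) (SO (2 * k)))] :
    (∀ E : OrientedEuclideanBundle.{u, v} (Suspension X) (2 * k),
      (E.IsTurnable η →
        Nat.card (ZerothHomotopy E.gaugeGroup) =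
          Nat.card (HomotopyClasses (Suspension X) (SO (2 * k)))) ∧
      (¬ E.IsTurnable η →
        2 * Nat.card (ZerothHomotopy E.gaugeGroup) =
          Nat.card (HomotopyClasses (Suspension X) (SO (2 * k))))) ∧
    (∀ (E : OrientedEuclideanBundle.{u, v} (Suspension X) (2 * k))
      (E' : OrientedEuclideanBundle.{u, w} (Suspension X) (2 * k)),
      Nonempty (E.gaugeGroup ≃ₕ E'.gaugeGroup) → (E.IsTurnable η ↔ E'.IsTurnable η)) := by
  refine ⟨fun E => E.card_zerothHomotopy_gaugeGroup (by omega) hη, ?_⟩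
  rintro E E' ⟨e⟩
  have h1 := E.card_zerothHomotopy_gaugeGroup (by omega) hη
  have h2 := E'.card_zerothHomotopy_gaugeGroup (by omega) hη
  have : Nonempty (HomotopyClasses (Suspension X) (SO (2 * k))) := ⟨Quotient.mk _ 1⟩
  -- Positivity, which rests on finiteness, makes the two possible counts incompatible: `m = N` and
  -- `2 * m = N` would force `N = 0`.
  have h3 : 0 < Nat.card (HomotopyClasses (Suspension X) (SO (2 * k))) := Nat.card_pos
  rw [Nat.card_zerothHomotopy_congr e] at h1
  by_cases h4 : E.IsTurnable η <;> by_cases h5 : E'.IsTurnable η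
  · exact iff_of_true h4 h5
  · have := h1.1 h4
    have := h2.2 h5
    omega
  · have := h1.2 h4
    have := h2.1 h5
    omega
  · exact iff_of_false h4 h5
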